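/- Let $\mathbb O$ be the real octonion algebra with unit $1=e_0$, imaginary units $e_1,\dots,e_7$ and product $e_ie_j=-\delta_{ij}+\sum_k\phi_{ijk}e_k$, where $\phi$ is completely antisymmetric with $\phi_{123}=\phi_{246}=\phi_{435}=\phi_{367}=\phi_{651}=\phi_{572}=\phi_{714}=1$ (and $\phi_{ijk}=0$ if $\{i,j,k\}$ is not one of these triads). Let $G_2=\mathrm{Aut}(\mathbb O)$ and let $\Gamma=2^3{\cdot}PSL_2(7)$ be the group of all $g\in G_2$ that map the set $\{\pm e_1,\dots,\pm e_7\}$ onto itself. For groups, $A{:}B$ denotes a split and $A{\cdot}B$ a non-split extension of a normal subgroup $A$ by $B$; $2^n$ is the elementary abelian group of order $2^n$, and $7{:}3$ is the non-abelian group of order $21$. Consider the linear maps (a bar denotes $\bar e_i=-e_i$, and all of them fix $e_0$) $$\alpha=(e_1e_2e_4e_3e_6e_5e_7),\qquad \beta=(e_2e_4e_6)(e_3e_7e_5),$$ $$\gamma:\ e_1\leftrightarrow -e_4,\ e_2\leftrightarrow -e_5,\ e_3\mapsto -e_3,\ e_6\mapsto e_6,\ e_7\mapsto -e_7,$$ $$\theta=(e_1\bar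 e_5)(e_2\bar e_3e_4\bar e_7\bar e_2e_3\bar e_4e_7)(e_6\bar e_6),$$ and the maps that are diagonal on $e_1,\dots,e_7$, $$N_1=(1,1,1,-1,-1,-1,-1),\quad N_2=(1,-1,-1,1,-1,-1,1),\quad N_7=(-1,1,-1,1,-1,1,-1).$$ Put $D=\langle N_1,N_2,N_7\rangle$. Then $|\Gamma|=1344$, $D\cong 2^3$, and $\Gamma$ is a non-split extension of its normal subgroup $D$ by $PSL_2(7)$. Moreover, $\Gamma$ has exactly three conjugacy classes of maximal subgroups, represented by the following pairwise non-conjugate subgroups. 1. $M_1=\langle\alpha,\beta,N_1\rangle=D{:}\langle\alpha,\beta\rangle$ with $\langle\alpha,\beta\rangle\cong 7{:}3$, so that $M_1$ has the structure $2^3{:}7{:}3$, of order $168$. It is a subgroup of $G_2$, i.e. it preserves the octonion multiplication, and its $7$-dimensional representation on the imaginary octonions is irreducible (over $\mathbb C$). The character of this representation is $7_1$: elements of $M_1$ have order $1,2,3,6$ or $7$, and on them the character is $7,-1,1,-1,0$ respectively. 2. $M_2=\langle\gamma,\theta\rangle$, of order $192$. It is the full stabilizer of the set $\{\pm e_6\}$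 in $\Gamma$, and it has the structure $4{\cdot}S_4{:}2$, where $4$ denotes the elementary abelian group $2^2$, in the following sense. Let $K$ be the subgroup of all $g\in M_2$ with $ge_6=e_6$. Then $D\cap K\cong 2^2$, $K$ is a non-split extension of $D\cap K$ by $S_4$, and $M_2$ is a split extension of $K$ by the group of order $2$. Identify $\mathbb C^3$ with the span of $e_1,e_2,e_3,e_4,e_5,e_7$ by $z\mapsto\sum_{i=1}^{3}\bigl(\mathrm{Re}(z_i)\,a_i+\mathrm{Im}(z_i)\,e_6a_i\bigr)$, where $(a_1,a_2,a_3)=(e_2,e_7,e_5)$ and $(e_6a_1,e_6a_2,e_6a_3)=(e_4,e_3,e_1)$. Then $K$ acts on $\mathbb C^3$ through an injective homomorphism $K\to SU(3)$. Every $g\in M_2\setminus K$ satisfies $ge_6=-e_6$ and acts as $z\mapsto U\bar z$ for some $U\in SU(3)$. Thus $K$ is a finite subgroup of $SU(3)$, and $M_2$ is a finite subgroup of the extension $SU(3){:}2$ of $SU(3)$ by complex conjugation. 3. $M_3=2^3{\cdot}S_4$, of order $192$: the stabilizer in $\Gamma$ of the quaternion subalgebra spanned by $1,e_2,e_4,e_6$.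 It is a non-split extension of $D\cong 2^3$ by $S_4$. Its action on the span of $e_1,e_3,e_5,e_7$ is given, in this basis, by an injective homomorphism $M_3\to SO(4)$, so that $M_3$ is isomorphic to a finite subgroup of $SO(4)$. -/

import Mathlib

open scoped Pointwise MatrixGroups

noncomputable section

namespace OctonionUnits

/-! ### The octonion algebra -/

/-- The underlying real vector space of the octonions; the coordinate `0` is the real part and the
coordinates `1, …, 7` are the coefficients of the imaginary units. -/
abbrev Oct : Type := Fin 8 → ℝ

/-- The basis vectors: `e 0` is the unit element, `e 1, …, e 7` are the imaginary units. -/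
def e (i : Fin 8) : Oct := Pi.single i 1

/-- The seven oriented triads `(i, j, k)` with `φ i j k = 1`. -/
def triads : List (Fin 8 × Fin 8 × Fin 8) :=
  [(1, 2, 3), (2, 4, 6), (4, 3, 5), (3, 6, 7), (6, 5, 1), (5, 7, 2), (7, 1, 4)]

/-- `(i, j, k)` is one of the seven oriented triads, up to cyclic rotation. -/
def IsTriad (i j k : Fin 8) : Prop :=
  (i, j, k) ∈ triads ∨ (j, k, i) ∈ triads ∨ (k, i, j) ∈ triads

instance (i j k : Fin 8) : Decidable (IsTriad i j k) := by
  unfold IsTriad; infer_instance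

/-- The completely antisymmetric symbol `φ`, with values in `{0, 1, -1}`. -/
def phi (i j k : Fin 8) : ℤ :=
  if IsTriad i j k then 1 else if IsTriad j i k then -1 else 0

/-- The structure constants: `e i * e j = ∑ k, coeff i j k • e k`, that is, `e 0` is a two-sided
unit and `e i * e j = -δ i j + ∑ k, φ i j k • e k` for the imaginary units. -/
def coeff (i j k : Fin 8) : ℤ :=
  if i = 0 then (if j = k then 1 else 0)
  else if j = 0 then (if i = k then 1 else 0)
  else (if i = j ∧ k = 0 then -1 else 0) + phi i j k

/-- Octonion multiplication. -/
def omul (x y : Oct) : Oct :=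
  fun k => ∑ i : Fin 8, ∑ j : Fin 8, (coeff i j k : ℝ) * (x i * y j)

/-- The compact Lie group `G₂`, as the automorphism group of the real octonion algebra. -/
def G2 : Subgroup (Oct ≃ₗ[ℝ] Oct) where
  carrier := {g | ∀ x y, g (omul x y) = omul (g x) (g y)}
  mul_mem' := by
    intro a b ha hb x y
    change a (b (omul x y)) = omul (a (b x)) (a (b y))
    rw [hb x y, ha]
  one_mem' := fun _ _ => rfl
  inv_mem' := by
    intro a ha x y
    apply a.injective
    have h := ha (a⁻¹ x) (a⁻¹ y)
    have hinv : ∀ z, a (a⁻¹ z) = z := fun z => a.apply_symm_apply z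
    rw [h, hinv, hinv, hinv]

/-- The set `{± e i | i = 1, …, 7}` of the imaginary units and their conjugates. -/
def units : Set Oct := {x | ∃ i : Fin 8, i ≠ 0 ∧ (x = e i ∨ x = -e i)}

/-- The group written `2³·PSL₂(7)`: all automorphisms of the octonion algebra that map the set
`{± e i}` onto itself. -/
def Gam : Subgroup (Oct ≃ₗ[ℝ] Oct) := G2 ⊓ MulAction.stabilizer (Oct ≃ₗ[ℝ] Oct) units

/-! ### Signed permutations of the units -/

/-- The linear map `e i ↦ ε i • e (σ i)`. -/
def signedPerm (σ : Equiv.Perm (Fin 8)) (ε : Fin 8 → ℤˣ) : Oct ≃ₗ[ℝ] Oct where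
  toFun x := fun j => ((ε (σ.symm j) : ℤ) : ℝ) * x (σ.symm j)
  map_add' x y := by ext j; simp [mul_add]
  map_smul' c x := by ext j; simp; ring
  invFun y := fun i => ((ε i : ℤ) : ℝ) * y (σ i)
  left_inv x := by
    ext i
    have h : ((ε i : ℤ) : ℝ) * ((ε i : ℤ) : ℝ) = 1 := by
      rw [← Int.cast_mul, ← Units.val_mul, Int.units_mul_self]; simp
    simp [← mul_assoc, h]
  right_inv y := by
    ext j
    have h : ((ε (σ.symm j) : ℤ) : ℝ) * ((ε (σ.symm j) : ℤ) : ℝ) = 1 := by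
      rw [← Int.cast_mul, ← Units.val_mul, Int.units_mul_self]; simp
    simp [← mul_assoc, h]

/-- `α = (e₁ e₂ e₄ e₃ e₆ e₅ e₇)`. -/
def alpha : Oct ≃ₗ[ℝ] Oct := signedPerm (List.formPerm [1, 2, 4, 3, 6, 5, 7]) 1

/-- `β = (e₁)(e₂ e₄ e₆)(e₃ e₇ e₅)`. -/
def beta : Oct ≃ₗ[ℝ] Oct :=
  signedPerm (List.formPerm [2, 4, 6] * List.formPerm [3, 7, 5]) 1

/-- `γ : e₁ ↔ -e₄, e₂ ↔ -e₅, e₃ ↦ -e₃, e₆ ↦ e₆, e₇ ↦ -e₇`. -/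
def gamma : Oct ≃ₗ[ℝ] Oct :=
  signedPerm (List.formPerm [1, 4] * List.formPerm [2, 5]) ![1, -1, -1, -1, -1, -1, 1, -1]

/-- `θ : e₁ ↔ -e₅, e₂ ↦ -e₃, e₃ ↦ -e₄, e₄ ↦ -e₇, e₇ ↦ e₂, e₆ ↦ -e₆`. -/
def theta : Oct ≃ₗ[ℝ] Oct :=
  signedPerm (List.formPerm [1, 5] * List.formPerm [2, 3, 4, 7]) ![1, -1, -1, -1, -1, -1, -1, 1]

/-- The diagonal map `N₁ = (1, 1, 1, -1, -1, -1, -1)` on `e₁, …, e₇`. -/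
def N1 : Oct ≃ₗ[ℝ] Oct := signedPerm 1 ![1, 1, 1, 1, -1, -1, -1, -1]

/-- The diagonal map `N₂ = (1, -1, -1, 1, -1, -1, 1)` on `e₁, …, e₇`. -/
def N2 : Oct ≃ₗ[ℝ] Oct := signedPerm 1 ![1, 1, -1, -1, 1, -1, -1, 1]

/-- The diagonal map `N₇ = (-1, 1, -1, 1, -1, 1, -1)` on `e₁, …, e₇`. -/
def N7 : Oct ≃ₗ[ℝ] Oct := signedPerm 1 ![1, -1, 1, -1, 1, -1, 1, -1]

/-! ### The subgroups -/

/-- The normal subgroup `2³` of sign changes. -/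
def D : Subgroup (Oct ≃ₗ[ℝ] Oct) := Subgroup.closure {N1, N2, N7}

/-- The group `7:3` generated by `α` and `β`. -/
def F21 : Subgroup (Oct ≃ₗ[ℝ] Oct) := Subgroup.closure {alpha, beta}

/-- The group `2³:7:3` generated by `α`, `β` and `N₁`. -/
def M1 : Subgroup (Oct ≃ₗ[ℝ] Oct) := Subgroup.closure {alpha, beta, N1}

/-- The group `4·S₄:2` generated by `γ` and `θ`. -/
def M2 : Subgroup (Oct ≃ₗ[ℝ] Oct) := Subgroup.closure {gamma, theta}

/-- The subgroup `4·S₄` of `4·S₄:2` consisting of the elements that fix `e₆` itself. -/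
def K : Subgroup (Oct ≃ₗ[ℝ] Oct) := M2 ⊓ MulAction.stabilizer (Oct ≃ₗ[ℝ] Oct) (e 6)

/-- The group `2³·S₄`: the elements of `2³·PSL₂(7)` that map the quaternion subalgebra spanned by
`1, e₂, e₄, e₆` onto itself. -/
def M3 : Subgroup (Oct ≃ₗ[ℝ] Oct) :=
  Gam ⊓ MulAction.stabilizer (Oct ≃ₗ[ℝ] Oct)
    (Submodule.span ℝ {e 0, e 2, e 4, e 6} : Set Oct)

/-! ### Group extensions and conjugacy -/

/-- `E` is a split extension (semidirect product) of its normal subgroup `N` by `B`. -/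
def IsSplitExt {E : Type*} [Group E] (N : Subgroup E) (B : Type*) [Group B] : Prop :=
  N.Normal ∧ ∃ C : Subgroup E, N.IsComplement' C ∧ Nonempty (C ≃* B)

/-- `E` is a non-split extension of its normal subgroup `N` by `B`. -/
def IsNonsplitExt {E : Type*} [Group E] (N : Subgroup E) (B : Type*) [Group B] : Prop :=
  (∃ _ : N.Normal, Nonempty (E ⧸ N ≃* B)) ∧ ¬ ∃ C : Subgroup E, N.IsComplement' C

/-- The subgroups `H` and `H'` of `E` are conjugate in `E`. -/
def AreConj {E : Type*} [Group E] (H H' : Subgroup E) : Prop :=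
  ∃ g : E, H = H'.map (MulAut.conj g).toMonoidHom

/-- The elementary abelian group of order `2 ^ n`. -/
abbrev ElemTwo (n : ℕ) : Type := Multiplicative (Fin n → ZMod 2)

/-! ### Coordinates for the actions of `SU(3)` and `SO(4)` -/

/-- The identification of `ℂ³` with the span of the six imaginary units other than `e₆`, on which
multiplication by the imaginary unit of `ℂ` is left multiplication by `e₆`
(`e₆ e₂ = e₄`, `e₆ e₇ = e₃`, `e₆ e₅ = e₁`). -/
def complexCoord (z : Fin 3 → ℂ) : Oct :=
  ∑ i, ((z i).re • e (![2, 7, 5] i) + (z i).im • e (![4, 3, 1] i))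

/-- The identification of `ℝ⁴` with the span of `e₁, e₃, e₅, e₇`, the orthogonal complement of the
quaternion subalgebra spanned by `1, e₂, e₄, e₆`. -/
def realCoord (v : Fin 4 → ℝ) : Oct := ∑ i, v i • e (![1, 3, 5, 7] i)

end OctonionUnits

end

/-!
Every element of `Gam` permutes the eight lines `ℝ • e i`, so it is a signed permutation (`SPerm`)
compatible with the multiplication table (`exists_isAut`). Forgetting the signs is a homomorphism
`sig` from `Gam` to the permutations of the indices; these are collineations of the Fano plane, and
the kernel is the group `D` of sign changes (`sig_eq_one_iff`).

*Order.* The stabilizer of `{± e₆}` permutes the four lines of the Fano plane off the point `6`.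
This action has kernel `D`, and `γ`, `θ` map to a transposition and a `4`-cycle that generate `S₄`;
hence the stabilizer is `M₂` and has order `8 * 24`. As `α` permutes the seven points transitively,
`Gam` has order `7 * 192`. In the same way `M₃` is an extension of `D` by the symmetric group on the
four points off the line `{2, 4, 6}`.

*The quotient.* The Bruhat decomposition of `SL₂(7)` gives an explicit map (`bruhat`) to the
permutations of the points. It is multiplicative in the left factor for the two generators
`!![1, 1; 0, 1]` and `!![0, -1; 1, 0]`, hence a homomorphism; its kernel is the center and its range
is that of `sig`.

*Non-splitting.* The coset `D θ` has order four in the quotient but consists of elements of order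
eight (`pow_four_ne_one_of_sig_eq`). A complement would contain an element of order four in this
coset. The cosets of `N₁ θ` in `K` and of a conjugate of `θ` in `M₃` serve the same purpose there.

*Maximal subgroups.* `D` is a minimal normal subgroup without a complement, so a maximal subgroup
contains it (`le_of_isCoatom`). A proper subgroup containing `D` that is not transitive on the
points has an invariant set of one to three points; the sum of these points in `𝔽₂³` is an invariant
point, or else the set is an invariant line. A transitive subgroup has order divisible by seven,
contains a conjugate of `α` by Sylow's theorem, and lies in a conjugate of `M₁` by the Bruhat
decomposition (`eq_top_of_not_le_M1`). Orders show that the three groups are themselves maximal.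

*Representations.* The sign changes separate the seven coordinate lines of the imaginary octonions
and `α` permutes them transitively, so `M₁` acts irreducibly. For `M₂` and `M₃` the Hermitian form,
the complex volume form and the real volume form are expressed by the octonion product
(`exists_SU3`, `exists_SO4`), hence are preserved by automorphisms.
-/

noncomputable section

namespace OctonionUnits

/-! ### Signed permutations -/

/-- A signed permutation of the eight basis vectors: the map `e i ↦ sign i • e (perm i)`. -/
@[ext] structure SPerm where
  perm : Equiv.Perm (Fin 8)
  sign : Fin 8 → ℤˣ

namespace SPerm

instance : DecidableEq SPerm := fun x y =>
  decidable_of_iff (x.perm = y.perm ∧ x.sign = y.sign) SPerm.ext_iff.symm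

instance : One SPerm := ⟨⟨1, 1⟩⟩

instance : Mul SPerm := ⟨fun x y => ⟨x.perm * y.perm, fun i => x.sign (y.perm i) * y.sign i⟩⟩

instance : Inv SPerm := ⟨fun x => ⟨x.perm⁻¹, fun i => x.sign (x.perm⁻¹ i)⟩⟩

@[simp] lemma one_perm : (1 : SPerm).perm = 1 := rfl
@[simp] lemma one_sign : (1 : SPerm).sign = 1 := rfl
@[simp] lemma mul_perm (x y : SPerm) : (x * y).perm = x.perm * y.perm := rfl
@[simp] lemma mul_sign (x y : SPerm) (i : Fin 8) :
    (x * y).sign i = x.sign (y.perm i) * y.sign i := rfl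

instance : Group SPerm := Group.ofLeftAxioms
  (fun x y z => by ext i <;> simp [mul_assoc])
  (fun x => by ext i <;> simp)
  (fun x => SPerm.ext (inv_mul_cancel x.perm) (by
    funext i
    change x.sign (x.perm⁻¹ (x.perm i)) * x.sign i = 1
    simp [Int.units_mul_self]))

/-- The underlying permutation of the indices, as a homomorphism. -/
def permHom : SPerm →* Equiv.Perm (Fin 8) where
  toFun := perm
  map_one' := rfl
  map_mul' _ _ := rfl

end SPerm

lemma e_apply (i j : Fin 8) : e i j = if j = i then 1 else 0 := by
  simp [e, Pi.single_apply]

lemma signedPerm_apply_e (σ : Equiv.Perm (Fin 8)) (ε : Fin 8 → ℤˣ) (i : Fin 8) :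
    signedPerm σ ε (e i) = ((ε i : ℤ) : ℝ) • e (σ i) := by
  ext j
  change ((ε (σ.symm j) : ℤ) : ℝ) * e i (σ.symm j) = ((ε i : ℤ) : ℝ) * e (σ i) j
  simp only [e_apply, Equiv.symm_apply_eq]
  by_cases h : j = σ i
  · subst h; simp
  · simp [h]

/-- Linear automorphisms of the octonions agree when they agree on the basis vectors. -/
lemma linearEquiv_ext_e {g h : Oct ≃ₗ[ℝ] Oct} (H : ∀ i, g (e i) = h (e i)) : g = h := by
  apply LinearEquiv.toLinearMap_injective
  apply (Pi.basisFun ℝ (Fin 8)).ext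
  intro i
  simpa [e] using H i

/-- The linear map of a signed permutation, as a homomorphism. -/
def toLin : SPerm →* (Oct ≃ₗ[ℝ] Oct) where
  toFun x := signedPerm x.perm x.sign
  map_one' := linearEquiv_ext_e fun i => by
    rw [signedPerm_apply_e]; simp
  map_mul' x y := linearEquiv_ext_e fun i => by
    change _ = signedPerm x.perm x.sign (signedPerm y.perm y.sign (e i))
    simp only [signedPerm_apply_e, map_smul, smul_smul, SPerm.mul_perm, SPerm.mul_sign,
      Equiv.Perm.mul_apply]
    congr 1
    push_cast
    ring

lemma toLin_apply_e (x : SPerm) (i : Fin 8) :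
    toLin x (e i) = ((x.sign i : ℤ) : ℝ) • e (x.perm i) := signedPerm_apply_e _ _ _

lemma smul_e_inj {s t : ℤˣ} {i j : Fin 8}
    (h : ((s : ℤ) : ℝ) • e i = ((t : ℤ) : ℝ) • e j) : i = j ∧ s = t := by
  have h1 := congrFun h i
  simp only [Pi.smul_apply, e_apply, smul_eq_mul, if_true, mul_one] at h1
  have hs : ((s : ℤ) : ℝ) ≠ 0 := by exact_mod_cast s.ne_zero
  by_cases hij : i = j
  · subst hij
    refine ⟨rfl, ?_⟩
    simp only [if_true, mul_one] at h1
    exact Units.ext (by exact_mod_cast h1)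
  · simp [hij] at h1

lemma toLin_injective : Function.Injective toLin := by
  intro x y h
  have H : ∀ i, x.perm i = y.perm i ∧ x.sign i = y.sign i := fun i =>
    smul_e_inj (by rw [← toLin_apply_e, ← toLin_apply_e, h])
  exact SPerm.ext (Equiv.ext fun i => (H i).1) (funext fun i => (H i).2)

/-! ### The multiplication table -/

/-- The exchange of the labels `5` and `7`, after which the index of a product of two units is the
bitwise exclusive or of the indices of the factors. -/
def relabel (i : Fin 8) : Fin 8 := if i = 5 then 7 else if i = 7 then 5 else i

/-- The index `k` with `e i * e j = ± e k`. -/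
def idx (i j : Fin 8) : Fin 8 := relabel (relabel i ^^^ relabel j)

/-- The sign `s` with `e i * e j = s • e (idx i j)`. -/
def sgn (i j : Fin 8) : ℤˣ := if coeff i j (idx i j) = 1 then 1 else -1

lemma coeff_eq : ∀ i j k, coeff i j k = if k = idx i j then (sgn i j : ℤ) else 0 := by
  decide +kernel

lemma omul_e (i j : Fin 8) : omul (e i) (e j) = ((sgn i j : ℤ) : ℝ) • e (idx i j) := by
  ext k
  simp only [omul, e_apply, coeff_eq, Pi.smul_apply, smul_eq_mul]
  simp

/-- Octonion multiplication as a bilinear map. -/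
def omulL : Oct →ₗ[ℝ] Oct →ₗ[ℝ] Oct :=
  LinearMap.mk₂ ℝ omul
    (fun x y z => by
      ext k
      simp only [omul, Pi.add_apply, ← Finset.sum_add_distrib]
      simp_rw [add_mul, mul_add])
    (fun c x y => by
      ext k; simp only [omul, Pi.smul_apply, smul_eq_mul, Finset.mul_sum]
      refine Finset.sum_congr rfl fun i _ => Finset.sum_congr rfl fun j _ => ?_
      ring)
    (fun x y z => by
      ext k
      simp only [omul, Pi.add_apply, ← Finset.sum_add_distrib]
      simp_rw [mul_add])
    (fun c x y => by
      ext k; simp only [omul, Pi.smul_apply, smul_eq_mul, Finset.mul_sum]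
      refine Finset.sum_congr rfl fun i _ => Finset.sum_congr rfl fun j _ => ?_
      ring)

lemma omulL_apply (x y : Oct) : omulL x y = omul x y := rfl

lemma mem_G2_iff {g : Oct ≃ₗ[ℝ] Oct} :
    g ∈ G2 ↔ ∀ i j, g (omul (e i) (e j)) = omul (g (e i)) (g (e j)) := by
  refine ⟨fun h i j => h _ _, fun h x y => ?_⟩
  have H : omulL.compr₂ (g : Oct →ₗ[ℝ] Oct) =
      omulL.compl₁₂ (g : Oct →ₗ[ℝ] Oct) (g : Oct →ₗ[ℝ] Oct) := by
    refine LinearMap.ext_basis (Pi.basisFun ℝ (Fin 8)) (Pi.basisFun ℝ (Fin 8)) fun i j => ?_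
    simpa [e, omulL_apply] using h i j
  exact congrFun (congrArg DFunLike.coe (congrFun (congrArg DFunLike.coe H) x)) y

/-- The signed permutations that fix `e 0` and respect the multiplication table. -/
structure IsAut (x : SPerm) : Prop where
  perm_zero : x.perm 0 = 0
  sign_zero : x.sign 0 = 1
  perm_idx : ∀ i j, x.perm (idx i j) = idx (x.perm i) (x.perm j)
  sign_idx : ∀ i j, x.sign (idx i j) * sgn i j = x.sign i * x.sign j * sgn (x.perm i) (x.perm j)

instance (x : SPerm) : Decidable (IsAut x) :=
  decidable_of_iff (x.perm 0 = 0 ∧ x.sign 0 = 1 ∧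
    (∀ i j, x.perm (idx i j) = idx (x.perm i) (x.perm j)) ∧
    ∀ i j, x.sign (idx i j) * sgn i j = x.sign i * x.sign j * sgn (x.perm i) (x.perm j))
  ⟨fun h => ⟨h.1, h.2.1, h.2.2.1, h.2.2.2⟩, fun h => ⟨h.1, h.2, h.3, h.4⟩⟩

lemma toLin_mem_G2_iff {x : SPerm} : toLin x ∈ G2 ↔
    ∀ i j, x.perm (idx i j) = idx (x.perm i) (x.perm j) ∧
      x.sign (idx i j) * sgn i j = x.sign i * x.sign j * sgn (x.perm i) (x.perm j) := by
  rw [mem_G2_iff]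
  refine forall₂_congr fun i j => ?_
  have h1 : toLin x (omul (e i) (e j)) =
      (((x.sign (idx i j) * sgn i j : ℤˣ) : ℤ) : ℝ) • e (x.perm (idx i j)) := by
    rw [omul_e, map_smul, toLin_apply_e, smul_smul]; push_cast; rw [mul_comm]
  have h2 : omul (toLin x (e i)) (toLin x (e j)) =
      (((x.sign i * x.sign j * sgn (x.perm i) (x.perm j) : ℤˣ) : ℤ) : ℝ) •
        e (idx (x.perm i) (x.perm j)) := by
    rw [toLin_apply_e, toLin_apply_e, ← omulL_apply]
    simp only [map_smul, LinearMap.smul_apply, omulL_apply, omul_e, smul_smul]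
    push_cast; congr 1; ring
  rw [h1, h2]
  exact ⟨smul_e_inj, fun ⟨h, h'⟩ => by rw [h, h']⟩

lemma units_smul_mem (s : ℤˣ) {j : Fin 8} (hj : j ≠ 0) : ((s : ℤ) : ℝ) • e j ∈ units := by
  rcases Int.units_eq_one_or s with rfl | rfl
  · exact ⟨j, hj, Or.inl (by simp)⟩
  · exact ⟨j, hj, Or.inr (by simp)⟩

lemma mem_units_iff {v : Oct} :
    v ∈ units ↔ ∃ (s : ℤˣ) (j : Fin 8), j ≠ 0 ∧ v = ((s : ℤ) : ℝ) • e j := by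
  constructor
  · rintro ⟨j, hj, rfl | rfl⟩
    · exact ⟨1, j, hj, by simp⟩
    · exact ⟨-1, j, hj, by simp⟩
  · rintro ⟨s, j, hj, rfl⟩
    exact units_smul_mem s hj

lemma toLin_mem_Gam {x : SPerm} (hx : IsAut x) : toLin x ∈ Gam := by
  refine ⟨toLin_mem_G2_iff.2 fun i j => ⟨hx.perm_idx i j, hx.sign_idx i j⟩, ?_⟩
  change toLin x • units = units
  have hne : ∀ j : Fin 8, j ≠ 0 → x.perm j ≠ 0 := fun j hj h =>
    hj (x.perm.injective (h.trans hx.perm_zero.symm))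
  have hne' : ∀ j : Fin 8, j ≠ 0 → x.perm.symm j ≠ 0 := fun j hj h =>
    hj (by rw [← x.perm.apply_symm_apply j, h, hx.perm_zero])
  ext v
  rw [Set.mem_smul_set]
  constructor
  · rintro ⟨u, hu, rfl⟩
    obtain ⟨s, j, hj, rfl⟩ := mem_units_iff.1 hu
    change toLin x _ ∈ units
    rw [map_smul, toLin_apply_e, smul_smul, ← Int.cast_mul, ← Units.val_mul]
    exact units_smul_mem _ (hne j hj)
  · intro hv
    obtain ⟨s, j, hj, rfl⟩ := mem_units_iff.1 hv
    refine ⟨(((s * x.sign (x.perm.symm j) : ℤˣ) : ℤ) : ℝ) • e (x.perm.symm j),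
      units_smul_mem _ (hne' j hj), ?_⟩
    change toLin x _ = _
    rw [map_smul, toLin_apply_e, smul_smul, ← Int.cast_mul, ← Units.val_mul,
      mul_assoc, Int.units_mul_self, mul_one, Equiv.apply_symm_apply]

lemma apply_e_zero {g : Oct ≃ₗ[ℝ] Oct} (hg : g ∈ G2) : g (e 0) = e 0 := by
  have h := hg (e 0) (g.symm (e 0))
  have h0 : ∀ x, omul (e 0) x = x := by
    intro x
    ext k
    simp [omul, e_apply, coeff]
  have h1 : ∀ x, omul x (e 0) = x := by
    intro x
    have h2 : ∀ i j : Fin 8, coeff i 0 j = if i = j then 1 else 0 := by decide +kernel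
    ext k
    simp [omul, e_apply, h2]
  rw [h0, g.apply_symm_apply, h1] at h
  exact h.symm

/-- Every element of `Gam` is a signed permutation that respects the multiplication table. -/
lemma exists_isAut {g : Oct ≃ₗ[ℝ] Oct} (hg : g ∈ Gam) : ∃ x, IsAut x ∧ toLin x = g := by
  obtain ⟨hG2, hst⟩ := hg
  change g • units = units at hst
  have key : ∀ i : Fin 8, ∃ (s : ℤˣ) (j : Fin 8), g (e i) = ((s : ℤ) : ℝ) • e j := by
    intro i
    by_cases hi : i = 0
    · exact ⟨1, 0, by rw [hi, apply_e_zero hG2]; simp⟩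
    · have : g (e i) ∈ units := by
        rw [← hst]
        exact Set.smul_mem_smul_set (a := g) (⟨i, hi, Or.inl rfl⟩ : e i ∈ units)
      obtain ⟨s, j, -, h⟩ := mem_units_iff.1 this
      exact ⟨s, j, h⟩
  choose s j hsj using key
  have hinj : Function.Injective j := by
    intro i i' h
    have : g (e i) = g (((s i * s i' : ℤˣ) : ℤ) • e i') := by
      rw [map_zsmul, hsj, hsj, h, ← Int.cast_smul_eq_zsmul ℝ, smul_smul, ← Int.cast_mul,
        ← Units.val_mul, mul_assoc, Int.units_mul_self, mul_one]
    have h2 := g.injective this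
    rw [← Int.cast_smul_eq_zsmul ℝ] at h2
    exact (smul_e_inj (s := 1) (t := s i * s i') (by simpa using h2)).1
  let x : SPerm := ⟨Equiv.ofBijective j (Finite.injective_iff_bijective.1 hinj), s⟩
  have hx : toLin x = g := linearEquiv_ext_e fun i => by
    rw [toLin_apply_e, hsj]; rfl
  have h2 := toLin_mem_G2_iff.1 (hx ▸ hG2)
  have h0 : x.perm 0 = 0 ∧ x.sign 0 = 1 := smul_e_inj (by
    rw [← toLin_apply_e, hx, apply_e_zero hG2]; simp)
  exact ⟨x, ⟨h0.1, h0.2, fun i j => (h2 i j).1, fun i j => (h2 i j).2⟩, hx⟩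

/-! ### Group-theoretic preliminaries -/

section Group

variable {E B : Type*} [Group E] [Group B]

lemma quotient_equiv_of_ker {N : Subgroup E} (f : E →* B)
    (hf : Function.Surjective f) (hN : N = f.ker) :
    ∃ _ : N.Normal, Nonempty (E ⧸ N ≃* B) := by
  subst hN
  exact ⟨inferInstance, ⟨QuotientGroup.quotientKerEquivOfSurjective f hf⟩⟩

/-- An extension does not split if some `t` has order dividing `n` in the quotient, while no
element of the coset of `t` satisfies `x ^ n = 1`: a complement would meet that coset in such an
element. -/
lemma isNonsplitExt_of_pow_ne_one {N : Subgroup E} (f : E →* B)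
    (hf : Function.Surjective f) (hN : N = f.ker) (t : E) (n : ℕ) (ht : f t ^ n = 1)
    (hx : ∀ x, f x = f t → x ^ n ≠ 1) : IsNonsplitExt N B := by
  refine ⟨quotient_equiv_of_ker f hf hN, ?_⟩
  rintro ⟨C, hC⟩
  have hmem : t ∈ (N : Set E) * (C : Set E) := by
    rw [hC.mul_eq]; trivial
  obtain ⟨d, hd, c, hc, rfl⟩ := hmem
  have hfc : f c = f (d * c) := by
    have : f d = 1 := by rw [hN] at hd; exact hd
    rw [map_mul, this, one_mul]
  refine hx c hfc ?_
  have h1 : c ^ n ∈ N := by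
    rw [hN, MonoidHom.mem_ker, map_pow, hfc, ht]
  have h2 : c ^ n ∈ C := pow_mem hc n
  exact Subgroup.disjoint_def.1 hC.disjoint h1 h2

/-- A group of exponent two and order `2 ^ n` is elementary abelian. -/
lemma nonempty_equiv_elemTwo {n : ℕ} (h : ∀ g : E, g * g = 1) (hc : Nat.card E = 2 ^ n) :
    Nonempty (E ≃* ElemTwo n) := by
  have hcomm : ∀ x y : E, x * y = y * x := fun x y => by
    have hinv : ∀ z : E, z⁻¹ = z := fun z => inv_eq_of_mul_eq_one_left (h z)
    rw [← hinv (x * y), mul_inv_rev, hinv, hinv]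
  let _ : CommGroup E := { (inferInstance : Group E) with mul_comm := hcomm }
  let _ : Module (ZMod 2) (Additive E) := AddCommGroup.zmodModule (n := 2) fun x => by
    rw [two_nsmul]; exact h x.toMul
  have : Finite (Additive E) := Nat.finite_of_card_ne_zero (by
    change Nat.card E ≠ 0
    rw [hc]; positivity)
  have hr : Module.finrank (ZMod 2) (Additive E) = n := by
    have := Module.natCard_eq_pow_finrank (K := ZMod 2) (V := Additive E)
    rw [Nat.card_zmod] at this
    exact Nat.pow_right_injective le_rfl (this.symm.trans hc)
  have e := LinearEquiv.ofFinrankEq (Additive E) (Fin n → ZMod 2) (R := ZMod 2) (by simp [hr])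
  exact ⟨AddEquiv.toMultiplicativeRight e.toAddEquiv⟩

/-- If a group permutes the values of an injective family, it acts on the indices. -/
lemma exists_permHom {P Y : Type*} [Group P] [MulAction P Y] (f : E →* P) {n : ℕ} (l : Fin n → Y)
    (hl : Function.Injective l) (h : ∀ (g : E) i, ∃ j, f g • l i = l j) :
    ∃ p : E →* Equiv.Perm (Fin n), ∀ g i, l (p g i) = f g • l i := by
  choose j hj using h
  have hone : ∀ i, j 1 i = i := fun i => hl (by rw [← hj, map_one, one_smul])
  have hmul : ∀ g g' i, j (g * g') i = j g (j g' i) := fun g g' i =>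
    hl (by rw [← hj, ← hj, ← hj, map_mul, mul_smul])
  refine ⟨⟨⟨fun g => ⟨j g, j g⁻¹, fun i => ?_, fun i => ?_⟩, ?_⟩, ?_⟩, fun g i => (hj g i).symm⟩
  · rw [← hmul, inv_mul_cancel, hone]
  · rw [← hmul, mul_inv_cancel, hone]
  · exact Equiv.ext hone
  · exact fun g g' => Equiv.ext (hmul g g')

/-- A homomorphism to a symmetric group is surjective if its range contains the standard cycle and
the transposition of two neighbours. -/
lemma surjective_of_finRotate {n : ℕ} (p : E →* Equiv.Perm (Fin (n + 2))) {x y : E}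
    (hx : p x = finRotate (n + 2)) (hy : p y = Equiv.swap 0 1) : Function.Surjective p := by
  rw [← MonoidHom.range_eq_top, eq_top_iff,
    ← Equiv.Perm.closure_cycle_adjacent_swap isCycle_finRotate support_finRotate 0,
    Subgroup.closure_le]
  rintro _ (rfl | rfl)
  · exact ⟨x, hx⟩
  · exact ⟨y, by rw [hy]; simp⟩

lemma card_eq_of_surjective {f : E →* B} (hf : Function.Surjective f) :
    Nat.card E = Nat.card f.ker * Nat.card B := by
  rw [Subgroup.card_eq_card_quotient_mul_card_subgroup f.ker, mul_comm,
    Nat.card_congr (QuotientGroup.quotientKerEquivOfSurjective f hf).toEquiv]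

lemma isComplement_sup {N C M : Subgroup E} (hM : M = N ⊔ C)
    (hn : ∀ c ∈ C, ∀ x ∈ N, c * x * c⁻¹ ∈ N) (hd : N ⊓ C = ⊥) :
    (N.subgroupOf M).Normal ∧ (N.subgroupOf M).IsComplement' (C.subgroupOf M) := by
  subst hM
  have hle : N ⊔ C ≤ Subgroup.normalizer (N : Set E) := by
    refine sup_le Subgroup.le_normalizer fun c hc => ?_
    rw [Subgroup.mem_normalizer_iff]
    refine fun x => ⟨hn c hc x, fun h => ?_⟩
    have := hn c⁻¹ (inv_mem hc) _ h
    simpa [mul_assoc] using this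
  have hnorm : (N.subgroupOf (N ⊔ C)).Normal := by
    rw [Subgroup.normal_subgroupOf_iff_le_normalizer le_sup_left]
    exact hle
  refine ⟨hnorm, Subgroup.isComplement'_of_disjoint_and_mul_eq_univ ?_ ?_⟩
  · rw [disjoint_iff, Subgroup.subgroupOf, Subgroup.subgroupOf, ← Subgroup.comap_inf, hd]
    exact Subgroup.bot_subgroupOf _
  · rw [← Subgroup.normal_mul, ← Subgroup.subgroupOf_sup le_sup_left le_sup_right,
      Subgroup.subgroupOf_self, Subgroup.coe_top]

/-- A maximal subgroup contains every abelian minimal normal subgroup that has no complement. -/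
lemma le_of_isCoatom {D H : Subgroup E} [D.Normal] (hH : IsCoatom H)
    (hcomm : ∀ x ∈ D, ∀ y ∈ D, x * y = y * x)
    (hmin : ∀ N : Subgroup E, N.Normal → N ≤ D → N = ⊥ ∨ N = D)
    (hns : ¬ ∃ C : Subgroup E, D.IsComplement' C) : D ≤ H := by
  by_contra hle
  have htop : D ⊔ H = ⊤ := hH.2 _ (lt_of_le_of_ne le_sup_right fun h => hle (h ▸ le_sup_left))
  have hnorm : (D ⊓ H).Normal := by
    rw [← Subgroup.normalizer_eq_top_iff, eq_top_iff, ← htop]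
    refine sup_le (fun d hd => ?_) fun x hx => ?_
    · rw [Subgroup.mem_normalizer_iff]
      have key : ∀ y ∈ D, d * y * d⁻¹ = y := fun y hy => by rw [hcomm d hd y hy]; group
      intro y
      constructor
      · intro hy
        rw [key y hy.1]; exact hy
      · intro hy
        have hyD : y ∈ D := by
          have := D.mul_mem (D.mul_mem (inv_mem hd) hy.1) hd
          simpa [mul_assoc] using this
        rw [key y hyD] at hy; exact hy
    · rw [Subgroup.mem_normalizer_iff]
      intro y
      have h1 : y ∈ D ↔ x * y * x⁻¹ ∈ D := (Subgroup.mem_normalizer_iff.1 (by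
        rw [Subgroup.normalizer_eq_top]; trivial) y)
      have h2 : y ∈ H ↔ x * y * x⁻¹ ∈ H := by
        rw [Subgroup.mul_mem_cancel_right _ (inv_mem hx), Subgroup.mul_mem_cancel_left _ hx]
      simp only [Subgroup.mem_inf, h1, h2]
  rcases hmin _ hnorm inf_le_left with h | h
  · refine hns ⟨H, Subgroup.isComplement'_of_disjoint_and_mul_eq_univ (disjoint_iff.2 h) ?_⟩
    rw [← Subgroup.normal_mul, htop, Subgroup.coe_top]
  · exact hle (inf_eq_left.1 h)

/-- A map that is multiplicative in its left argument for a set of generators is a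
homomorphism. -/
lemma map_mul_of_closure {S : Set E} (hS : Subgroup.closure S = ⊤) (f : E → B) (h1 : f 1 = 1)
    (hf : ∀ s ∈ S, ∀ x, f (s * x) = f s * f x) (x y : E) : f (x * y) = f x * f y := by
  have hx : x ∈ Subgroup.closure S := hS ▸ Subgroup.mem_top x
  induction hx using Subgroup.closure_induction generalizing y with
  | mem x hx => exact hf x hx y
  | one => rw [one_mul, h1, one_mul]
  | mul x x' _ _ hx hx' => rw [mul_assoc, hx, hx', hx, mul_assoc]
  | inv x _ hx =>
    have h2 := fun z => hx (x⁻¹ * z)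
    simp only [mul_inv_cancel_left] at h2
    have h3 := hx x⁻¹
    rw [mul_inv_cancel, h1] at h3
    rw [eq_inv_of_mul_eq_one_right h3.symm, h2 y, inv_mul_cancel_left]

end Group

/-! ### The generators as signed permutations -/

namespace SPerm

/-- The signed permutation `α`. -/
def a : SPerm := ⟨List.formPerm [1, 2, 4, 3, 6, 5, 7], 1⟩
/-- The signed permutation `β`. -/
def b : SPerm := ⟨List.formPerm [2, 4, 6] * List.formPerm [3, 7, 5], 1⟩
/-- The signed permutation `γ`. -/
def c : SPerm := ⟨List.formPerm [1, 4] * List.formPerm [2, 5], ![1, -1, -1, -1, -1, -1, 1, -1]⟩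
/-- The signed permutation `θ`. -/
def t : SPerm :=
  ⟨List.formPerm [1, 5] * List.formPerm [2, 3, 4, 7], ![1, -1, -1, -1, -1, -1, -1, 1]⟩
/-- The signed permutation `N₁`. -/
def n1 : SPerm := ⟨1, ![1, 1, 1, 1, -1, -1, -1, -1]⟩
/-- The signed permutation `N₂`. -/
def n2 : SPerm := ⟨1, ![1, 1, -1, -1, 1, -1, -1, 1]⟩
/-- The signed permutation `N₇`. -/
def n7 : SPerm := ⟨1, ![1, -1, 1, -1, 1, -1, 1, -1]⟩

/-- `α` in the form of a table of values, which evaluates faster than a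
product of transpositions. -/
def aTable : SPerm :=
  ⟨⟨![0, 2, 4, 6, 3, 7, 5, 1], ![0, 7, 1, 4, 2, 6, 3, 5], by decide, by decide⟩, 1⟩
/-- `β` in the form of a table of values. -/
def bTable : SPerm :=
  ⟨⟨![0, 1, 4, 7, 6, 3, 2, 5], ![0, 1, 6, 5, 2, 7, 4, 3], by decide, by decide⟩, 1⟩

lemma a_eq : a = aTable := by decide +kernel
lemma b_eq : b = bTable := by decide +kernel

/-- The element `N₁ ^ i * N₂ ^ j * N₇ ^ k`. -/
def diag (i j k : Fin 2) : SPerm := n1 ^ (i : ℕ) * n2 ^ (j : ℕ) * n7 ^ (k : ℕ)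

lemma isAut_a : IsAut a := by decide +kernel
lemma isAut_b : IsAut b := by decide +kernel
lemma isAut_c : IsAut c := by decide +kernel
lemma isAut_t : IsAut t := by decide +kernel
lemma isAut_n1 : IsAut n1 := by decide +kernel
lemma isAut_n2 : IsAut n2 := by decide +kernel
lemma isAut_n7 : IsAut n7 := by decide +kernel
lemma isAut_diag : ∀ i j k, IsAut (diag i j k) := by decide +kernel

lemma diag_perm : ∀ i j k, (diag i j k).perm = 1 := by decide +kernel
lemma diag_sq : ∀ i j k, diag i j k * diag i j k = 1 := by decide +kernel

lemma n1_eq : n1 = (c * t) ^ 3 := by decide +kernel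
lemma n2_eq : n2 = (c * t) ^ 3 * t ^ 4 := by decide +kernel
lemma n7_eq : n7 = c * t ^ 4 * c := by decide +kernel

lemma exists_diag {x : SPerm} (hx : IsAut x) (h : x.perm = 1) : ∃ i j k, x = diag i j k := by
  have key : ∀ p q r : ℤˣ, ∃ i j k,
      (⟨1, ![1, p, q, p * q, r, p * q * r, q * r, p * r]⟩ : SPerm) = diag i j k := by
    decide +kernel
  have hs : ∀ i j, sgn i j = sgn (x.perm i) (x.perm j) := by simp [h]
  have h' : ∀ i j, x.sign (idx i j) = x.sign i * x.sign j := fun i j => by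
    have := hx.sign_idx i j
    rwa [← hs, mul_left_inj] at this
  obtain ⟨i, j, k, hd⟩ := key (x.sign 1) (x.sign 2) (x.sign 4)
  refine ⟨i, j, k, hd ▸ SPerm.ext h (funext fun l => ?_)⟩
  have h3 : x.sign 3 = x.sign 1 * x.sign 2 := h' 1 2
  have h5 : x.sign 5 = x.sign 3 * x.sign 4 := h' 3 4
  have h6 : x.sign 6 = x.sign 2 * x.sign 4 := h' 2 4
  have h7 : x.sign 7 = x.sign 1 * x.sign 4 := h' 1 4
  fin_cases l
  · exact hx.sign_zero
  · rfl
  · rfl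
  · exact h3
  · rfl
  · rw [h3] at h5; exact h5
  · exact h6
  · exact h7

end SPerm

open SPerm

lemma toLin_a : toLin a = alpha := rfl
lemma toLin_b : toLin b = beta := rfl
lemma toLin_c : toLin c = gamma := rfl
lemma toLin_t : toLin t = theta := rfl
lemma toLin_n1 : toLin n1 = N1 := rfl
lemma toLin_n2 : toLin n2 = N2 := rfl
lemma toLin_n7 : toLin n7 = N7 := rfl

/-! ### The homomorphism to the permutations of the indices -/

lemma Gam_le_range : Gam ≤ toLin.range := fun _ hg =>
  let ⟨x, _, hx⟩ := exists_isAut hg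
  ⟨x, hx⟩

/-- The signed permutation by which an element of `Gam` acts. -/
def code : Gam →* SPerm :=
  (MonoidHom.ofInjective toLin_injective).symm.toMonoidHom.comp (Subgroup.inclusion Gam_le_range)

@[simp] lemma toLin_code (g : Gam) : toLin (code g) = g.1 :=
  congrArg Subtype.val ((MonoidHom.ofInjective toLin_injective).apply_symm_apply
    (Subgroup.inclusion Gam_le_range g))

lemma code_eq_iff {g : Gam} {x : SPerm} : code g = x ↔ g.1 = toLin x := by
  rw [← toLin_injective.eq_iff, toLin_code]

lemma code_injective : Function.Injective code := fun g h H =>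
  Subtype.ext (by rw [← toLin_code, H, toLin_code])

lemma isAut_code (g : Gam) : IsAut (code g) := by
  obtain ⟨x, hx, h⟩ := exists_isAut g.2
  rwa [code_eq_iff.2 h.symm]

/-- The permutation of the indices induced by an element of `Gam`. -/
def sig : Gam →* Equiv.Perm (Fin 8) := permHom.comp code

lemma sig_apply (g : Gam) : sig g = (code g).perm := rfl

@[simp] lemma sig_zero (g : Gam) : sig g 0 = 0 := (isAut_code g).perm_zero

lemma sig_idx (g : Gam) (i j : Fin 8) : sig g (idx i j) = idx (sig g i) (sig g j) :=
  (isAut_code g).perm_idx i j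

lemma apply_e (g : Gam) (i : Fin 8) : g.1 (e i) = (((code g).sign i : ℤ) : ℝ) • e (sig g i) := by
  rw [← toLin_code, toLin_apply_e]; rfl

/-- The element of `Gam` given by a signed permutation. -/
def mkGam (x : SPerm) (hx : IsAut x) : Gam := ⟨toLin x, toLin_mem_Gam hx⟩

@[simp] lemma code_mkGam (x : SPerm) (hx : IsAut x) : code (mkGam x hx) = x := code_eq_iff.2 rfl

@[simp] lemma sig_mkGam (x : SPerm) (hx : IsAut x) : sig (mkGam x hx) = x.perm := by
  rw [sig_apply, code_mkGam]

/-- `α` as an element of `Gam`. -/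
def ga : Gam := mkGam a isAut_a
/-- `β` as an element of `Gam`. -/
def gb : Gam := mkGam b isAut_b
/-- `γ` as an element of `Gam`. -/
def gc : Gam := mkGam c isAut_c
/-- `θ` as an element of `Gam`. -/
def gt : Gam := mkGam t isAut_t

@[simp] lemma code_ga : code ga = a := code_mkGam _ _
@[simp] lemma code_gt : code gt = t := code_mkGam _ _
@[simp] lemma sig_ga : sig ga = a.perm := sig_mkGam _ _
@[simp] lemma sig_gb : sig gb = b.perm := sig_mkGam _ _
@[simp] lemma sig_gc : sig gc = c.perm := sig_mkGam _ _
@[simp] lemma sig_gt : sig gt = t.perm := sig_mkGam _ _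

/-! ### The group of sign changes -/

lemma mem_D_iff_diag {g : Oct ≃ₗ[ℝ] Oct} : g ∈ D ↔ ∃ i j k, g = toLin (diag i j k) := by
  constructor
  · intro hg
    have h1 : D ≤ Gam := (Subgroup.closure_le _).2 (by
      rintro x (rfl | rfl | rfl)
      · exact toLin_n1 ▸ toLin_mem_Gam isAut_n1
      · exact toLin_n2 ▸ toLin_mem_Gam isAut_n2
      · exact toLin_n7 ▸ toLin_mem_Gam isAut_n7)
    have h2 : D ≤ permHom.ker.map toLin := (Subgroup.closure_le _).2 (by
      rintro x (rfl | rfl | rfl)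
      · exact ⟨n1, rfl, rfl⟩
      · exact ⟨n2, rfl, rfl⟩
      · exact ⟨n7, rfl, rfl⟩)
    obtain ⟨x, hx, rfl⟩ := exists_isAut (h1 hg)
    obtain ⟨y, hy, hxy⟩ := h2 hg
    obtain rfl := toLin_injective hxy
    obtain ⟨i, j, k, rfl⟩ := exists_diag hx hy
    exact ⟨i, j, k, rfl⟩
  · rintro ⟨i, j, k, rfl⟩
    simp only [diag, map_mul, map_pow, toLin_n1, toLin_n2, toLin_n7]
    refine mul_mem (mul_mem (pow_mem ?_ _) (pow_mem ?_ _)) (pow_mem ?_ _) <;>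
      exact Subgroup.subset_closure (by simp)

lemma D_le_Gam : D ≤ Gam := fun g hg => by
  obtain ⟨i, j, k, rfl⟩ := mem_D_iff_diag.1 hg
  exact toLin_mem_Gam (isAut_diag i j k)

lemma sig_eq_one_iff {g : Gam} : sig g = 1 ↔ g.1 ∈ D := by
  rw [mem_D_iff_diag]
  constructor
  · intro h
    obtain ⟨i, j, k, h⟩ := exists_diag (isAut_code g) h
    exact ⟨i, j, k, code_eq_iff.1 h⟩
  · rintro ⟨i, j, k, h⟩
    rw [sig_apply, code_eq_iff.2 h, diag_perm]

lemma D_subgroupOf_Gam : D.subgroupOf Gam = sig.ker := by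
  ext g
  rw [MonoidHom.mem_ker, sig_eq_one_iff, Subgroup.mem_subgroupOf]

lemma mul_self_of_mem_D {g : Oct ≃ₗ[ℝ] Oct} (hg : g ∈ D) : g * g = 1 := by
  obtain ⟨i, j, k, rfl⟩ := mem_D_iff_diag.1 hg
  rw [← map_mul, diag_sq, map_one]

lemma card_D : Nat.card D = 8 := by
  let f : Fin 2 × Fin 2 × Fin 2 → D := fun i =>
    ⟨toLin (diag i.1 i.2.1 i.2.2), mem_D_iff_diag.2 ⟨_, _, _, rfl⟩⟩
  have hf : Function.Bijective f := by
    constructor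
    · have key : ∀ i j : Fin 2 × Fin 2 × Fin 2,
          diag i.1 i.2.1 i.2.2 = diag j.1 j.2.1 j.2.2 → i = j := by decide +kernel
      exact fun i j h => key i j (toLin_injective (congrArg Subtype.val h))
    · rintro ⟨g, hg⟩
      obtain ⟨i, j, k, rfl⟩ := mem_D_iff_diag.1 hg
      exact ⟨(i, j, k), rfl⟩
  rw [← Nat.card_congr (Equiv.ofBijective f hf)]
  simp

lemma D_equiv : Nonempty (D ≃* ElemTwo 3) :=
  nonempty_equiv_elemTwo (fun g => Subtype.ext (mul_self_of_mem_D g.2)) (by rw [card_D]; rfl)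

/-- The coset `D θ` consists of elements of order eight, although `θ` has order four modulo `D`. -/
lemma pow_four_ne_one_of_sig_eq {g : Gam} (h : sig g = sig gt) : g ^ 4 ≠ 1 := by
  have key : ∀ i j k, (diag i j k * t) ^ 4 ≠ 1 := by decide +kernel
  have h1 : sig (g * gt⁻¹) = 1 := by rw [map_mul, map_inv, h, mul_inv_cancel]
  obtain ⟨i, j, k, h2⟩ := mem_D_iff_diag.1 (sig_eq_one_iff.1 h1)
  have h3 : code g = diag i j k * t := by
    rw [← code_eq_iff.2 h2, map_mul, map_inv, code_gt, inv_mul_cancel_right]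
  intro h4
  exact key i j k (by rw [← h3, ← map_pow, h4, map_one])

lemma pow_four_ne_one_of_sig_eq_conj {g x : Gam} (h : sig g = sig (x * gt * x⁻¹)) : g ^ 4 ≠ 1 := by
  intro h4
  have : sig (x⁻¹ * g * x) = sig gt := by
    rw [map_mul, map_mul, h]; simp [mul_assoc]
  refine pow_four_ne_one_of_sig_eq this ?_
  have h5 := conj_pow (a := x⁻¹) (b := g) (i := 4)
  rw [inv_inv] at h5
  rw [h5, h4]; simp

/-! ### The stabilizers of a point and of a line -/

lemma sig_idx_of_fixed {g : Gam} {i j : Fin 8} (hi : sig g i = i) (hj : sig g j = j) :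
    sig g (idx i j) = idx i j := by rw [sig_idx, hi, hj]

lemma mem_stabilizer_pair_iff (g : Gam) (i : Fin 8) :
    g.1 ∈ MulAction.stabilizer (Oct ≃ₗ[ℝ] Oct) ({e i, -e i} : Set Oct) ↔ sig g i = i := by
  have hpm : ∀ v, v ∈ ({e i, -e i} : Set Oct) ↔ ∃ s : ℤˣ, v = ((s : ℤ) : ℝ) • e i := by
    intro v
    constructor
    · rintro (rfl | rfl)
      · exact ⟨1, by simp⟩
      · exact ⟨-1, by simp⟩
    · rintro ⟨s, rfl⟩
      rcases Int.units_eq_one_or s with rfl | rfl <;> simp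
  rw [MulAction.mem_stabilizer_set]
  constructor
  · intro h
    obtain ⟨s, hs⟩ := (hpm _).1 ((h (e i)).2 (Or.inl rfl))
    change g.1 (e i) = _ at hs
    rw [apply_e] at hs
    exact (smul_e_inj hs).1
  · intro h v
    have hg : g.1 (e i) = (((code g).sign i : ℤ) : ℝ) • e i := by rw [apply_e, h]
    rw [hpm, hpm]
    change (∃ s : ℤˣ, g.1 v = _) ↔ _
    constructor
    · rintro ⟨s, hs⟩
      refine ⟨s * (code g).sign i, g.1.injective ?_⟩
      rw [hs, map_smul, hg, smul_smul, ← Int.cast_mul, ← Units.val_mul, mul_assoc,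
        Int.units_mul_self, mul_one]
    · rintro ⟨s, rfl⟩
      exact ⟨s * (code g).sign i, by
        rw [map_smul, hg, smul_smul, ← Int.cast_mul, ← Units.val_mul]⟩

/-- The four indices of the units orthogonal to the quaternion subalgebra spanned by
`1, e₂, e₄, e₆`. -/
def offLine : Finset (Fin 8) := {1, 3, 5, 7}

lemma mem_span_iff (v : Oct) :
    v ∈ (Submodule.span ℝ {e 0, e 2, e 4, e 6} : Set Oct) ↔ ∀ j ∈ offLine, v j = 0 := by
  constructor
  · intro hv
    induction hv using Submodule.span_induction with
    | mem x hx =>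
      rintro j hj
      rcases hx with rfl | rfl | rfl | rfl <;> rw [e_apply, if_neg] <;> rintro rfl <;>
        exact absurd hj (by decide)
    | zero => intro j _; rfl
    | add x y _ _ hx hy => intro j hj; rw [Pi.add_apply, hx j hj, hy j hj, add_zero]
    | smul c x _ hx => intro j hj; rw [Pi.smul_apply, hx j hj, smul_zero]
  · intro h
    have hv : v = v 0 • e 0 + v 2 • e 2 + v 4 • e 4 + v 6 • e 6 := by
      have h1 := h 1 (by decide)
      have h3 := h 3 (by decide)
      have h5 := h 5 (by decide)
      have h7 := h 7 (by decide)
      ext j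
      fin_cases j <;> simp [e_apply, h1, h3, h5, h7]
    rw [hv]
    have hm : ∀ x ∈ ({e 0, e 2, e 4, e 6} : Set Oct),
        x ∈ Submodule.span ℝ ({e 0, e 2, e 4, e 6} : Set Oct) :=
      fun x hx => Submodule.subset_span hx
    exact add_mem (add_mem (add_mem
      (Submodule.smul_mem _ _ (hm _ (by simp))) (Submodule.smul_mem _ _ (hm _ (by simp))))
      (Submodule.smul_mem _ _ (hm _ (by simp)))) (Submodule.smul_mem _ _ (hm _ (by simp)))

lemma apply_coord (g : Gam) (v : Oct) (i : Fin 8) :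
    g.1 v (sig g i) = (((code g).sign i : ℤ) : ℝ) * v i := by
  conv_lhs => rw [← toLin_code]
  change (((code g).sign ((code g).perm.symm ((code g).perm i)) : ℤ) : ℝ) *
    v ((code g).perm.symm ((code g).perm i)) = _
  rw [Equiv.symm_apply_apply]

lemma mem_M3_iff (g : Gam) : g.1 ∈ M3 ↔ ∀ i, sig g i ∈ offLine ↔ i ∈ offLine := by
  have h0 : g.1 ∈ M3 ↔ g.1 ∈ MulAction.stabilizer (Oct ≃ₗ[ℝ] Oct)
      (Submodule.span ℝ {e 0, e 2, e 4, e 6} : Set Oct) := ⟨fun h => h.2, fun h => ⟨g.2, h⟩⟩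
  rw [h0, MulAction.mem_stabilizer_set]
  have h1 : ∀ v : Oct, g.1 v ∈ (Submodule.span ℝ {e 0, e 2, e 4, e 6} : Set Oct) ↔
      ∀ i, sig g i ∈ offLine → v i = 0 := by
    intro v
    rw [mem_span_iff, ← (sig g).forall_congr_right]
    refine forall_congr' fun i => imp_congr_right fun _ => ?_
    rw [apply_coord, mul_eq_zero, or_iff_right]
    exact_mod_cast ((code g).sign i).ne_zero
  constructor
  · intro h i
    have h2 := h (e i)
    change g.1 (e i) ∈ _ ↔ _ at h2
    have hd : ∀ j, e i j = 0 ↔ j ≠ i := fun j => by simp [e_apply]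
    rw [h1, mem_span_iff] at h2
    simp only [hd] at h2
    constructor
    · intro hi
      by_contra hn
      exact h2.2 (fun j hj hji => hn (hji ▸ hj)) i hi rfl
    · intro hi
      by_contra hn
      exact h2.1 (fun j hj hji => hn (hji ▸ hj)) i hi rfl
  · intro h v
    change g.1 v ∈ _ ↔ _
    rw [h1, mem_span_iff]
    exact forall_congr' fun i => by rw [h i]

/-! ### The quotient `S₄` of the stabilizer of a line -/

lemma M3_le_Gam : M3 ≤ Gam := inf_le_left

lemma D_le_M3 : D ≤ M3 := fun g hg =>
  (mem_M3_iff ⟨g, D_le_Gam hg⟩).2 fun i => by rw [sig_eq_one_iff.2 hg]; rfl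

/-- The stabilizer of the quaternion subalgebra acts on the four points off the line
`{2, 4, 6}`. -/
lemma exists_M3_permHom : ∃ p : M3 →* Equiv.Perm (Fin 4),
    ∀ g i, (![1, 7, 3, 5] : Fin 4 → Fin 8) (p g i) =
      sig (Subgroup.inclusion M3_le_Gam g) (![1, 7, 3, 5] i) := by
  refine exists_permHom (sig.comp (Subgroup.inclusion M3_le_Gam)) _ (by decide) fun g i => ?_
  have h : ∀ j ∈ offLine, ∃ i : Fin 4, j = ![1, 7, 3, 5] i := by decide
  exact h _ (((mem_M3_iff (Subgroup.inclusion M3_le_Gam g)).1 g.2 _).2 (by fin_cases i <;> decide))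

/-- `α⁴ θ α⁻⁴`, which acts on `{1, 7, 3, 5}` as a cycle of length four. -/
def gtLine : Gam := ga ^ 4 * gt * (ga ^ 4)⁻¹

/-- A conjugate of `γ` that fixes the points `3`, `5` and exchanges `1` and `7`. -/
def gcLine : Gam := (gb * ga ^ 2) * gc * (gb * ga ^ 2)⁻¹

lemma sig_gtLine : sig gtLine = a.perm ^ 4 * t.perm * (a.perm ^ 4)⁻¹ := by simp [gtLine]

lemma sig_gcLine :
    sig gcLine = (b.perm * a.perm ^ 2) * c.perm * (b.perm * a.perm ^ 2)⁻¹ := by simp [gcLine]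

lemma gtLine_mem : gtLine.1 ∈ M3 := by
  rw [mem_M3_iff, sig_gtLine]; decide +kernel

lemma gcLine_mem : gcLine.1 ∈ M3 := by
  rw [mem_M3_iff, sig_gcLine]; decide +kernel

/-- The action of `M3` on the four points off the line realizes `M3` as an extension of `D` by
`S₄`. -/
lemma exists_M3_quotient : ∃ p : M3 →* Equiv.Perm (Fin 4), Function.Surjective p ∧
    D.subgroupOf M3 = p.ker := by
  obtain ⟨p, hp⟩ := exists_M3_permHom
  have hinj : Function.Injective (![1, 7, 3, 5] : Fin 4 → Fin 8) := by decide
  refine ⟨p, ?_, ?_⟩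
  · refine surjective_of_finRotate p (x := ⟨gtLine.1, gtLine_mem⟩) (y := ⟨gcLine.1, gcLine_mem⟩)
      (Equiv.ext fun i => hinj ?_) (Equiv.ext fun i => hinj ?_)
    · have h : ∀ i, (a.perm ^ 4 * t.perm * (a.perm ^ 4)⁻¹) (![1, 7, 3, 5] i) =
          (![1, 7, 3, 5] : Fin 4 → Fin 8) (finRotate 4 i) := by decide +kernel
      rw [hp, ← h, ← sig_gtLine]; rfl
    · have h : ∀ i, ((b.perm * a.perm ^ 2) * c.perm * (b.perm * a.perm ^ 2)⁻¹) (![1, 7, 3, 5] i) =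
          (![1, 7, 3, 5] : Fin 4 → Fin 8) (Equiv.swap 0 1 i) := by decide +kernel
      rw [hp, ← h, ← sig_gcLine]; rfl
  · ext g
    set g' : Gam := Subgroup.inclusion M3_le_Gam g
    rw [Subgroup.mem_subgroupOf, MonoidHom.mem_ker]
    change g'.1 ∈ D ↔ _
    rw [← sig_eq_one_iff]
    constructor
    · intro h
      refine Equiv.ext fun i => hinj ?_
      rw [hp]
      change sig g' _ = _
      rw [h]; rfl
    · intro h
      have h4 : ∀ i, sig g' (![1, 7, 3, 5] i) = ![1, 7, 3, 5] i := fun i => by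
        rw [← hp, h]; rfl
      have h1 : sig g' 1 = 1 := h4 0
      have h7 : sig g' 7 = 7 := h4 1
      have h3 : sig g' 3 = 3 := h4 2
      have h5 : sig g' 5 = 5 := h4 3
      have h2 : sig g' 2 = 2 := sig_idx_of_fixed h1 h3
      have h4' : sig g' 4 = 4 := sig_idx_of_fixed h3 h5
      have h6 : sig g' 6 = 6 := sig_idx_of_fixed h3 h7
      ext i : 1
      fin_cases i
      exacts [sig_zero g', h1, h2, h3, h4', h5, h6, h7]

lemma card_M3 : Nat.card M3 = 192 := by
  obtain ⟨p, hp, hk⟩ := exists_M3_quotient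
  rw [card_eq_of_surjective hp, ← hk, Nat.card_congr (Subgroup.subgroupOfEquivOfLe D_le_M3).toEquiv,
    card_D, Nat.card_perm, Nat.card_fin]
  rfl

lemma M3_nonsplit : IsNonsplitExt (D.subgroupOf M3) (Equiv.Perm (Fin 4)) := by
  obtain ⟨p, hp, hk⟩ := exists_M3_quotient
  have hker : ∀ x y : M3, p x = p y →
      sig (Subgroup.inclusion M3_le_Gam x) = sig (Subgroup.inclusion M3_le_Gam y) := by
    intro x y h
    have h1 : x * y⁻¹ ∈ D.subgroupOf M3 := by
      rw [hk, MonoidHom.mem_ker, map_mul, map_inv, h, mul_inv_cancel]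
    have h2 : sig (Subgroup.inclusion M3_le_Gam (x * y⁻¹)) = 1 := sig_eq_one_iff.2 h1
    rw [map_mul, map_inv, map_mul, map_inv] at h2
    exact mul_inv_eq_one.1 h2
  have h4 : p ⟨gtLine.1, gtLine_mem⟩ ^ 4 = 1 := by
    rw [← map_pow, ← MonoidHom.mem_ker, ← hk]
    change (gtLine ^ 4).1 ∈ D
    rw [← sig_eq_one_iff, map_pow, sig_gtLine]
    decide +kernel
  refine isNonsplitExt_of_pow_ne_one p hp hk ⟨gtLine.1, gtLine_mem⟩ 4 h4 fun x hx h => ?_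
  refine pow_four_ne_one_of_sig_eq_conj (g := Subgroup.inclusion M3_le_Gam x) (x := ga ^ 4)
    (hker _ _ hx) ?_
  rw [← map_pow, h, map_one]

/-! ### The quotient `S₄` of the stabilizer of a point -/

/-- The stabilizer of the set `{± e₆}` in `Gam`. -/
def Stab6 : Subgroup (Oct ≃ₗ[ℝ] Oct) :=
  Gam ⊓ MulAction.stabilizer (Oct ≃ₗ[ℝ] Oct) ({e 6, -e 6} : Set Oct)

lemma Stab6_le_Gam : Stab6 ≤ Gam := inf_le_left

lemma mem_Stab6_iff (g : Gam) : g.1 ∈ Stab6 ↔ sig g 6 = 6 := by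
  rw [← mem_stabilizer_pair_iff]
  exact ⟨fun h => h.2, fun h => ⟨g.2, h⟩⟩

/-- The four lines of the Fano plane that do not contain the point `6`. -/
def linesOff6 : Fin 4 → Finset (Fin 8) := ![{1, 2, 3}, {3, 4, 5}, {1, 4, 7}, {2, 5, 7}]

lemma linesOff6_injective : Function.Injective linesOff6 := by decide +kernel

lemma exists_Stab6_permHom : ∃ p : Stab6 →* Equiv.Perm (Fin 4),
    ∀ g i, linesOff6 (p g i) = sig (Subgroup.inclusion Stab6_le_Gam g) • linesOff6 i := by
  refine exists_permHom (sig.comp (Subgroup.inclusion Stab6_le_Gam)) _ linesOff6_injective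
    fun g i => ?_
  set g' : Gam := Subgroup.inclusion Stab6_le_Gam g
  change ∃ j, sig g' • _ = _
  have h6 : sig g' 6 = 6 := (mem_Stab6_iff g').1 g.2
  have hne : ∀ {x y : Fin 8}, sig g' y = y → x ≠ y → sig g' x ≠ y := fun hy hx h =>
    hx ((sig g').injective (h.trans hy.symm))
  have key : ∀ x y : Fin 8, x ≠ 0 → y ≠ 0 → x ≠ 6 → y ≠ 6 → idx x y ≠ 6 → x ≠ y →
      ∃ j, ({x, y, idx x y} : Finset (Fin 8)) = linesOff6 j := by decide +kernel
  have hl : ∀ i, ∃ x y : Fin 8, x ≠ 0 ∧ y ≠ 0 ∧ x ≠ 6 ∧ y ≠ 6 ∧ idx x y ≠ 6 ∧ x ≠ y ∧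
      linesOff6 i = {x, y, idx x y} := by decide +kernel
  obtain ⟨x, y, hx0, hy0, hx6, hy6, h, hxy, hi⟩ := hl i
  obtain ⟨j, hj⟩ := key (sig g' x) (sig g' y) (hne (sig_zero g') hx0) (hne (sig_zero g') hy0)
    (hne h6 hx6) (hne h6 hy6) (by rw [← sig_idx]; exact hne h6 h) ((sig g').injective.ne hxy)
  refine ⟨j, ?_⟩
  rw [hi, ← hj, ← sig_idx, Finset.smul_finset_insert, Finset.smul_finset_insert,
    Finset.smul_finset_singleton]
  rfl

lemma gc_mem_Stab6 : gc.1 ∈ Stab6 := by rw [mem_Stab6_iff, sig_gc]; decide +kernel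

lemma gt_mem_Stab6 : gt.1 ∈ Stab6 := by rw [mem_Stab6_iff, sig_gt]; decide +kernel

/-- The action on the four lines off the point `6` realizes the stabilizer of `{± e₆}` as an
extension of `D` by `S₄`, and already `γ` and `θ` generate the quotient. -/
lemma exists_Stab6_quotient : ∃ p : Stab6 →* Equiv.Perm (Fin 4),
    p ⟨gt.1, gt_mem_Stab6⟩ = finRotate 4 ∧ p ⟨gc.1, gc_mem_Stab6⟩ = Equiv.swap 0 1 ∧
    D.subgroupOf Stab6 = p.ker := by
  obtain ⟨p, hp⟩ := exists_Stab6_permHom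
  refine ⟨p, Equiv.ext fun i => linesOff6_injective ?_, Equiv.ext fun i => linesOff6_injective ?_,
    ?_⟩
  · have h : ∀ i, t.perm • linesOff6 i = linesOff6 (finRotate 4 i) := by decide +kernel
    rw [hp, ← h, ← sig_gt]; rfl
  · have h : ∀ i, c.perm • linesOff6 i = linesOff6 (Equiv.swap 0 1 i) := by decide +kernel
    rw [hp, ← h, ← sig_gc]; rfl
  · ext g
    set g' : Gam := Subgroup.inclusion Stab6_le_Gam g
    rw [Subgroup.mem_subgroupOf, MonoidHom.mem_ker]
    change g'.1 ∈ D ↔ _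
    rw [← sig_eq_one_iff]
    constructor
    · intro h
      refine Equiv.ext fun i => linesOff6_injective ?_
      rw [hp]
      change sig g' • _ = _
      rw [h, one_smul]; rfl
    · intro h
      have h4 : ∀ i, sig g' • linesOff6 i = linesOff6 i := fun i => by
        rw [← hp, h]; rfl
      -- a point other than `6` is the intersection of two of the four lines
      have key : ∀ x : Fin 8, x ≠ 0 → x ≠ 6 → ∃ i j, x ∈ linesOff6 i ∧ x ∈ linesOff6 j ∧
          ∀ y, y ∈ linesOff6 i → y ∈ linesOff6 j → y = x := by decide +kernel
      ext x : 1
      by_cases hx0 : x = 0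
      · rw [hx0, sig_zero]; rfl
      by_cases hx6 : x = 6
      · rw [hx6]; exact (mem_Stab6_iff g').1 g.2
      obtain ⟨i, j, hi, hj, hij⟩ := key x hx0 hx6
      exact hij _ (h4 i ▸ Finset.smul_mem_smul_finset (a := sig g') hi)
        (h4 j ▸ Finset.smul_mem_smul_finset (a := sig g') hj)

lemma gamma_mem_M2 : gamma ∈ M2 := Subgroup.subset_closure (by simp)

lemma theta_mem_M2 : theta ∈ M2 := Subgroup.subset_closure (by simp)

lemma D_le_M2 : D ≤ M2 := by
  refine (Subgroup.closure_le _).2 ?_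
  have hc := gamma_mem_M2
  have ht := theta_mem_M2
  rintro _ (rfl | rfl | rfl)
  · rw [← toLin_n1, n1_eq, map_pow, map_mul, toLin_c, toLin_t]
    exact pow_mem (mul_mem hc ht) _
  · rw [← toLin_n2, n2_eq, map_mul, map_pow, map_pow, map_mul, toLin_c, toLin_t]
    exact mul_mem (pow_mem (mul_mem hc ht) _) (pow_mem ht _)
  · rw [← toLin_n7, n7_eq, map_mul, map_mul, map_pow, toLin_c, toLin_t]
    exact mul_mem (mul_mem hc (pow_mem ht _)) hc

lemma M2_eq_Stab6 : M2 = Stab6 := by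
  have hle : M2 ≤ Stab6 := (Subgroup.closure_le _).2 (by
    rintro _ (rfl | rfl)
    exacts [gc_mem_Stab6, gt_mem_Stab6])
  refine le_antisymm hle fun g hg => ?_
  obtain ⟨p, hpt, hpc, hk⟩ := exists_Stab6_quotient
  have hs : Function.Surjective (p.comp (Subgroup.inclusion hle)) :=
    surjective_of_finRotate _ (x := ⟨theta, theta_mem_M2⟩) (y := ⟨gamma, gamma_mem_M2⟩) hpt hpc
  obtain ⟨m, hm⟩ := hs (p ⟨g, hg⟩)
  have h1 : (⟨g, hg⟩ : Stab6) * (Subgroup.inclusion hle m)⁻¹ ∈ D.subgroupOf Stab6 := by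
    rw [hk, MonoidHom.mem_ker, map_mul, map_inv, ← hm]
    exact mul_inv_cancel _
  have h2 : g * m.1⁻¹ ∈ M2 := D_le_M2 h1
  simpa using mul_mem h2 m.2

lemma M2_le_Gam : M2 ≤ Gam := M2_eq_Stab6 ▸ Stab6_le_Gam

lemma mem_M2_iff (g : Gam) : g.1 ∈ M2 ↔ sig g 6 = 6 := by rw [M2_eq_Stab6, mem_Stab6_iff]

/-- The action of `M2` on the four lines off the point `6`. -/
lemma exists_M2_quotient : ∃ p : M2 →* Equiv.Perm (Fin 4), Function.Surjective p ∧
    p ⟨theta, theta_mem_M2⟩ = finRotate 4 ∧ D.subgroupOf M2 = p.ker := by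
  obtain ⟨p, hpt, hpc, hk⟩ := exists_Stab6_quotient
  refine ⟨p.comp (Subgroup.inclusion M2_eq_Stab6.le),
    surjective_of_finRotate _ (x := ⟨theta, theta_mem_M2⟩) (y := ⟨gamma, gamma_mem_M2⟩) hpt hpc,
    hpt, ?_⟩
  rw [← MonoidHom.comap_ker, ← hk]
  rfl

lemma card_M2 : Nat.card M2 = 192 := by
  obtain ⟨p, hp, -, hk⟩ := exists_M2_quotient
  rw [card_eq_of_surjective hp, ← hk, Nat.card_congr (Subgroup.subgroupOfEquivOfLe D_le_M2).toEquiv,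
    card_D, Nat.card_perm, Nat.card_fin]
  rfl

/-! ### The subgroup of elements fixing `e₆` -/

lemma K_le_M2 : K ≤ M2 := inf_le_left

lemma mem_K_iff {g : Oct ≃ₗ[ℝ] Oct} : g ∈ K ↔ g ∈ M2 ∧ g (e 6) = e 6 := Iff.rfl

lemma apply_e6_of_not_mem_K {g : Oct ≃ₗ[ℝ] Oct} (hg : g ∈ M2) (hK : g ∉ K) :
    g (e 6) = -e 6 := by
  set g' : Gam := ⟨g, M2_le_Gam hg⟩
  have h1 : g (e 6) = (((code g').sign 6 : ℤ) : ℝ) • e 6 := by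
    have := apply_e g' 6
    rwa [(mem_M2_iff g').1 hg] at this
  rcases Int.units_eq_one_or ((code g').sign 6) with h | h <;> rw [h] at h1
  · exact absurd (mem_K_iff.2 ⟨hg, by simpa using h1⟩) hK
  · simpa using h1

lemma N1_mem_D : N1 ∈ D := Subgroup.subset_closure (by simp)

lemma N1_apply_e6 : N1 (e 6) = -e 6 := by
  rw [← toLin_n1, toLin_apply_e]
  have h1 : n1.sign 6 = -1 := rfl
  have h2 : n1.perm 6 = 6 := rfl
  rw [h1, h2]; simp

lemma e_ne_neg (i : Fin 8) : e i ≠ -e i := fun h => by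
  have := smul_e_inj (s := 1) (t := -1) (i := i) (j := i) (by simpa using h)
  exact absurd this.2 (by decide)

lemma N1_mul_self : N1 * N1 = 1 := mul_self_of_mem_D N1_mem_D

lemma N1_mul_mem_K {g : Oct ≃ₗ[ℝ] Oct} (hg : g ∈ M2) (hK : g ∉ K) : N1 * g ∈ K := by
  refine mem_K_iff.2 ⟨mul_mem (D_le_M2 N1_mem_D) hg, ?_⟩
  change N1 (g (e 6)) = _
  rw [apply_e6_of_not_mem_K hg hK, map_neg, N1_apply_e6, neg_neg]

lemma mem_zpowers_N1_iff {g : Oct ≃ₗ[ℝ] Oct} : g ∈ Subgroup.zpowers N1 ↔ g = 1 ∨ g = N1 := by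
  have hsq : N1 ^ 2 = 1 := by rw [pow_two, N1_mul_self]
  constructor
  · rintro ⟨n, rfl⟩
    rcases Int.even_or_odd' n with ⟨m, rfl | rfl⟩
    · left
      simp [zpow_mul, hsq]
    · right
      simp [zpow_add, zpow_mul, hsq]
  · rintro (rfl | rfl)
    · exact one_mem _
    · exact Subgroup.mem_zpowers _

lemma orderOf_N1 : orderOf N1 = 2 := by
  refine orderOf_eq_prime (by rw [pow_two, N1_mul_self]) fun h => ?_
  have := N1_apply_e6
  rw [h] at this
  exact e_ne_neg 6 this

lemma K_isComplement : (K.subgroupOf M2).Normal ∧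
    (K.subgroupOf M2).IsComplement' ((Subgroup.zpowers N1).subgroupOf M2) := by
  refine isComplement_sup (le_antisymm (fun g hg => ?_) (sup_le K_le_M2 ?_)) ?_ ?_
  · by_cases hK : g ∈ K
    · exact (le_sup_left : K ≤ _) hK
    · have h := mul_mem ((le_sup_right : _ ≤ K ⊔ _) (Subgroup.mem_zpowers N1))
        ((le_sup_left : K ≤ K ⊔ _) (N1_mul_mem_K hg hK))
      rwa [← mul_assoc, N1_mul_self, one_mul] at h
  · rw [Subgroup.zpowers_le]; exact D_le_M2 N1_mem_D
  · intro c hc x hx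
    rcases mem_zpowers_N1_iff.1 hc with rfl | rfl
    · simpa using hx
    · have hinv : N1⁻¹ = N1 := inv_eq_of_mul_eq_one_left N1_mul_self
      rw [hinv]
      have hN := D_le_M2 N1_mem_D
      refine mem_K_iff.2 ⟨mul_mem (mul_mem hN hx.1) hN, ?_⟩
      change N1 (x (N1 (e 6))) = _
      rw [N1_apply_e6, map_neg, (mem_K_iff.1 hx).2, map_neg, N1_apply_e6, neg_neg]
  · rw [Subgroup.eq_bot_iff_forall]
    rintro x ⟨hxK, hx⟩
    rcases mem_zpowers_N1_iff.1 hx with rfl | rfl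
    · rfl
    · have := (mem_K_iff.1 hxK).2
      rw [N1_apply_e6] at this
      exact absurd this.symm (e_ne_neg 6)

lemma zpowers_N1_le_M2 : Subgroup.zpowers N1 ≤ M2 := by
  rw [Subgroup.zpowers_le]; exact D_le_M2 N1_mem_D

lemma card_zpowers_N1 : Nat.card (Subgroup.zpowers N1) = 2 := by
  rw [Nat.card_zpowers, orderOf_N1]

lemma zpowers_equiv {p : ℕ} [Fact p.Prime] {E : Type*} [Group E] (h : Nat.card E = p) :
    Nonempty (E ≃* Multiplicative (ZMod p)) :=
  ⟨mulEquivOfPrimeCardEq h (by simp)⟩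

lemma M2_split : IsSplitExt (K.subgroupOf M2) (Multiplicative (ZMod 2)) := by
  obtain ⟨e⟩ := zpowers_equiv card_zpowers_N1
  exact ⟨K_isComplement.1, _, K_isComplement.2,
    ⟨(Subgroup.subgroupOfEquivOfLe zpowers_N1_le_M2).trans e⟩⟩

lemma card_K : Nat.card K = 96 := by
  have h := K_isComplement.2.card_mul_card
  rw [Nat.card_congr (Subgroup.subgroupOfEquivOfLe K_le_M2).toEquiv,
    Nat.card_congr (Subgroup.subgroupOfEquivOfLe zpowers_N1_le_M2).toEquiv, card_zpowers_N1,
    card_M2] at h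
  omega

lemma exists_K_quotient : ∃ p : K →* Equiv.Perm (Fin 4), Function.Surjective p ∧
    (D ⊓ K).subgroupOf K = p.ker ∧ ∃ t : K, p t = finRotate 4 ∧
    sig (Subgroup.inclusion (K_le_M2.trans M2_le_Gam) t) = sig gt := by
  obtain ⟨p, hp, hpt, hk⟩ := exists_M2_quotient
  -- multiplication by `N₁` moves an element of `M2` into `K` without changing its image
  have key : ∀ m : M2, ∃ k : K, p (Subgroup.inclusion K_le_M2 k) = p m ∧
      sig (Subgroup.inclusion (K_le_M2.trans M2_le_Gam) k) =
        sig (Subgroup.inclusion M2_le_Gam m) := by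
    intro m
    by_cases hm : m.1 ∈ K
    · exact ⟨⟨m.1, hm⟩, rfl, rfl⟩
    · refine ⟨⟨N1 * m.1, N1_mul_mem_K m.2 hm⟩, ?_, ?_⟩
      · have h1 : (⟨N1, D_le_M2 N1_mem_D⟩ : M2) ∈ p.ker := by
          rw [← hk]; exact N1_mem_D
        change p (⟨N1, D_le_M2 N1_mem_D⟩ * m) = _
        rw [map_mul, MonoidHom.mem_ker.1 h1, one_mul]
      · change sig (⟨N1, D_le_Gam N1_mem_D⟩ * Subgroup.inclusion M2_le_Gam m) = _
        rw [map_mul, sig_eq_one_iff.2 N1_mem_D, one_mul]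
  refine ⟨p.comp (Subgroup.inclusion K_le_M2), fun q => ?_, ?_, ?_⟩
  · obtain ⟨m, rfl⟩ := hp q
    obtain ⟨k, hk, -⟩ := key m
    exact ⟨k, hk⟩
  · rw [← MonoidHom.comap_ker, ← hk, Subgroup.inf_subgroupOf_right]
    rfl
  · obtain ⟨k, h1, h2⟩ := key ⟨theta, theta_mem_M2⟩
    exact ⟨k, h1.trans hpt, h2⟩

lemma card_D_inf_K : Nat.card (D ⊓ K : Subgroup (Oct ≃ₗ[ℝ] Oct)) = 4 := by
  obtain ⟨p, hp, hk, -⟩ := exists_K_quotient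
  have h := card_eq_of_surjective hp
  rw [← hk, Nat.card_congr (Subgroup.subgroupOfEquivOfLe inf_le_right).toEquiv, card_K,
    Nat.card_perm, Nat.card_fin] at h
  change 96 = _ * 24 at h
  omega

lemma D_inf_K_equiv : Nonempty ((D ⊓ K : Subgroup (Oct ≃ₗ[ℝ] Oct)) ≃* ElemTwo 2) :=
  nonempty_equiv_elemTwo (fun g => Subtype.ext (mul_self_of_mem_D g.2.1))
    (by rw [card_D_inf_K]; rfl)

lemma K_nonsplit : IsNonsplitExt ((D ⊓ K).subgroupOf K) (Equiv.Perm (Fin 4)) := by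
  obtain ⟨p, hp, hk, t, hpt, hst⟩ := exists_K_quotient
  refine isNonsplitExt_of_pow_ne_one p hp hk t 4 (by rw [hpt]; decide +kernel) fun x hx h => ?_
  have h1 : x * t⁻¹ ∈ (D ⊓ K).subgroupOf K := by
    rw [hk, MonoidHom.mem_ker, map_mul, map_inv, hx, mul_inv_cancel]
  have h2 : sig (Subgroup.inclusion (K_le_M2.trans M2_le_Gam) (x * t⁻¹)) = 1 :=
    sig_eq_one_iff.2 h1.1
  rw [map_mul, map_inv, map_mul, map_inv] at h2
  refine pow_four_ne_one_of_sig_eq ((mul_inv_eq_one.1 h2).trans hst) ?_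
  rw [← map_pow, h, map_one]

/-! ### The order and the generators of `Gam` -/

lemma exists_pow_a : ∀ i : Fin 8, i ≠ 0 → ∃ k : Fin 7, (a.perm ^ (k : ℕ)) 6 = i := by
  decide +kernel

lemma exists_pow_ga_mul_mem_M2 (g : Gam) : ∃ k : ℕ, ((ga ^ k)⁻¹ * g).1 ∈ M2 := by
  obtain ⟨k, hk⟩ := exists_pow_a (sig g 6) fun h =>
    absurd ((sig g).injective (h.trans (sig_zero g).symm)) (by decide)
  refine ⟨k, (mem_M2_iff _).2 ?_⟩
  rw [map_mul, map_inv, map_pow, sig_ga, Equiv.Perm.mul_apply, ← hk]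
  exact Equiv.symm_apply_apply _ _

lemma Gam_closure : Subgroup.closure {ga, gc, gt} = (⊤ : Subgroup Gam) := by
  rw [eq_top_iff]
  rintro g -
  obtain ⟨k, hk⟩ := exists_pow_ga_mul_mem_M2 g
  have hM2 : M2 ≤ (Subgroup.closure {ga, gc, gt}).map Gam.subtype :=
    (Subgroup.closure_le _).2 (by
      rintro _ (rfl | rfl)
      · exact ⟨gc, Subgroup.subset_closure (by simp), rfl⟩
      · exact ⟨gt, Subgroup.subset_closure (by simp), rfl⟩)
  obtain ⟨m, hm, hmg⟩ := hM2 hk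
  have h1 : ga ∈ Subgroup.closure {ga, gc, gt} := Subgroup.subset_closure (by simp)
  have h2 := mul_mem (pow_mem h1 k) hm
  rwa [(Subtype.ext hmg : m = _), mul_inv_cancel_left] at h2

lemma card_Gam : Nat.card Gam = 1344 := by
  let _ : MulAction Gam (Fin 8) := MulAction.compHom (Fin 8) sig
  have hst : MulAction.stabilizer Gam (6 : Fin 8) = M2.subgroupOf Gam := by
    ext g
    rw [Subgroup.mem_subgroupOf, mem_M2_iff]
    rfl
  have horb : MulAction.orbit Gam (6 : Fin 8) = {i | i ≠ 0} := by
    ext i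
    constructor
    · rintro ⟨g, rfl⟩ h
      exact absurd ((sig g).injective (h.trans (sig_zero g).symm)) (by decide)
    · intro hi
      obtain ⟨k, hk⟩ := exists_pow_a i hi
      exact ⟨ga ^ (k : ℕ), by rw [← hk, ← sig_ga, ← map_pow]; rfl⟩
  have h := Subgroup.card_mul_index (MulAction.stabilizer Gam (6 : Fin 8))
  rw [MulAction.index_stabilizer, horb, hst,
    Nat.card_congr (Subgroup.subgroupOfEquivOfLe M2_le_Gam).toEquiv, card_M2] at h
  have h7 : ({i | i ≠ 0} : Set (Fin 8)).ncard = 7 := by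
    rw [Set.ncard_eq_toFinset_card']; decide +kernel
  rw [h7] at h
  exact h.symm

/-! ### The isomorphism of `Gam / D` with `PSL₂(7)` -/

/-- The exponent `k ∈ {0, 1, 2}` with `t = ± 3 ^ k` in `ZMod 7`. -/
def log3 (t : ZMod 7) : ℕ := if t = 1 ∨ t = -1 then 0 else if t = 3 ∨ t = -3 then 1 else 2

/-- `θ²` permutes the points as the involution `(2 4)(3 7)`, which plays the role of
`!![0, -1; 1, 0]`. -/
def w : Equiv.Perm (Fin 8) := t.perm ^ 2

lemma w_eq : w = ⟨![0, 1, 4, 7, 2, 5, 6, 3], ![0, 1, 4, 7, 2, 5, 6, 3], by decide, by decide⟩ := by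
  decide +kernel

/-- The image of the matrix `!![p, q; r, s]`, read off from its Bruhat decomposition. -/
def bruhat (p q r s : ZMod 7) : Equiv.Perm (Fin 8) :=
  if r = 0 then b.perm ^ log3 p * a.perm ^ (q * p⁻¹).val
  else a.perm ^ (p * r⁻¹).val * w * b.perm ^ log3 r * a.perm ^ (s * r⁻¹).val

lemma bruhat_T_mul : ∀ p q r s : ZMod 7, p * s - q * r = 1 →
    bruhat (p + r) (q + s) r s = a.perm * bruhat p q r s := by
  simp only [bruhat, a_eq, b_eq, w_eq]
  decide +kernel

lemma bruhat_S_mul : ∀ p q r s : ZMod 7, p * s - q * r = 1 →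
    bruhat (-r) (-s) p q = w * bruhat p q r s := by
  simp only [bruhat, a_eq, b_eq, w_eq]
  decide +kernel

lemma eq_of_bruhat_eq_one : ∀ p q r s : ZMod 7, p * s - q * r = 1 → bruhat p q r s = 1 →
    q = 0 ∧ r = 0 ∧ p * p = 1 ∧ s = p := by
  simp only [bruhat, a_eq, b_eq, w_eq]
  decide +kernel

lemma bruhat_scalar : ∀ p : ZMod 7, p * p = 1 → bruhat p 0 0 p = 1 := by
  simp only [bruhat, a_eq, b_eq, w_eq]
  decide +kernel

section

open Matrix

/-- Not an instance, since the ring structure on `ZMod 7` would then be found through its field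
structure. -/
lemma fact_prime_seven : Fact (Nat.Prime 7) := ⟨by norm_num⟩

/-- The transvection `!![1, x; 0, 1]`. -/
def slT (x : ZMod 7) : SpecialLinearGroup (Fin 2) (ZMod 7) := ⟨!![1, x; 0, 1], by simp⟩

/-- The matrix `!![0, -1; 1, 0]`. -/
def slS : SpecialLinearGroup (Fin 2) (ZMod 7) := ⟨!![0, -1; 1, 0], by simp⟩

lemma coe_slT (x : ZMod 7) : (slT x : Matrix (Fin 2) (Fin 2) (ZMod 7)) = !![1, x; 0, 1] := rfl

lemma coe_slS : (slS : Matrix (Fin 2) (Fin 2) (ZMod 7)) = !![0, -1; 1, 0] := rfl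

lemma coe_slT_mul (x : ZMod 7) (A : SpecialLinearGroup (Fin 2) (ZMod 7)) :
    (slT x * A : SpecialLinearGroup (Fin 2) (ZMod 7)).1 =
      !![A 0 0 + x * A 1 0, A 0 1 + x * A 1 1; A 1 0, A 1 1] := by
  rw [Matrix.SpecialLinearGroup.coe_mul, coe_slT, Matrix.eta_fin_two A.1]
  simp

lemma coe_slS_mul (A : SpecialLinearGroup (Fin 2) (ZMod 7)) :
    (slS * A : SpecialLinearGroup (Fin 2) (ZMod 7)).1 = !![-A 1 0, -A 1 1; A 0 0, A 0 1] := by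
  rw [Matrix.SpecialLinearGroup.coe_mul, coe_slS, Matrix.eta_fin_two A.1]
  simp

lemma slT_mem (x : ZMod 7) : slT x ∈ Subgroup.closure {slT 1, slS} := by
  have h : ∀ n : ℕ, slT n = slT 1 ^ n := by
    intro n
    induction n with
    | zero => exact Subtype.ext (by simp [coe_slT, Matrix.one_fin_two])
    | succ n ih =>
      rw [pow_succ', ← ih]
      exact Subtype.ext (by rw [coe_slT_mul]; simp [coe_slT, add_comm])
  rw [← ZMod.natCast_zmod_val x, h]
  exact pow_mem (Subgroup.subset_closure (by simp)) _

/-- If the lower left entry `r` is invertible, then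
`!![p, q; r, s] = T ^ ((p + 1) / r) * S * T ^ r * S * T ^ ((s + 1) / r)`. -/
lemma sl_closure : Subgroup.closure {slT 1, slS} = ⊤ := by
  have := fact_prime_seven
  have hS : slS ∈ Subgroup.closure {slT 1, slS} := Subgroup.subset_closure (by simp)
  have key : ∀ A : SpecialLinearGroup (Fin 2) (ZMod 7), A 1 0 ≠ 0 →
      A ∈ Subgroup.closure {slT 1, slS} := by
    intro A hA
    have hdet := A.det_coe
    rw [det_fin_two] at hdet
    have h : A = slT ((A 0 0 + 1) / A 1 0) * slS * slT (A 1 0) * slS *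
        slT ((A 1 1 + 1) / A 1 0) := by
      simp only [mul_assoc]
      refine Subtype.ext ?_
      rw [coe_slT_mul, coe_slS_mul, coe_slT_mul, coe_slS_mul, coe_slT]
      ext i j
      fin_cases i <;> fin_cases j <;> simp <;> field_simp <;>
        first | ring1 | linear_combination -hdet
    rw [h]
    exact mul_mem (mul_mem (mul_mem (mul_mem (slT_mem _) hS) (slT_mem _)) hS) (slT_mem _)
  rw [eq_top_iff]
  rintro A -
  by_cases hA : A 1 0 = 0
  · have h : (slS * A) 1 0 ≠ 0 := by
      have hdet := A.det_coe
      rw [det_fin_two, hA] at hdet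
      intro h0
      have h00 : A 0 0 = 0 := by rw [coe_slS_mul] at h0; exact h0
      rw [h00] at hdet
      simp at hdet
    exact (Subgroup.mul_mem_cancel_left _ hS).1 (key _ h)
  · exact key A hA

/-- The action of `SL₂(7)` on the points of the Fano plane. -/
def slHom : SpecialLinearGroup (Fin 2) (ZMod 7) →* Equiv.Perm (Fin 8) where
  toFun A := bruhat (A 0 0) (A 0 1) (A 1 0) (A 1 1)
  map_one' := by simpa using bruhat_scalar 1 (by simp)
  map_mul' := map_mul_of_closure sl_closure
    (fun A => bruhat (A 0 0) (A 0 1) (A 1 0) (A 1 1)) (by simpa using bruhat_scalar 1 (by simp)) (by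
      rintro _ (rfl | rfl) A
      all_goals
        have hdet := A.det_coe
        rw [det_fin_two] at hdet
      · have h1 : bruhat 1 1 0 1 = a.perm := by decide +kernel
        rw [coe_slT_mul, coe_slT]
        simpa [h1] using bruhat_T_mul _ _ _ _ hdet
      · have h1 : bruhat 0 (-1) 1 0 = w := by decide +kernel
        rw [coe_slS_mul, coe_slS]
        simpa [h1] using bruhat_S_mul _ _ _ _ hdet)

lemma slHom_apply (A : SpecialLinearGroup (Fin 2) (ZMod 7)) :
    slHom A = bruhat (A 0 0) (A 0 1) (A 1 0) (A 1 1) := rfl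

lemma slHom_T : slHom (slT 1) = a.perm := by
  change bruhat 1 1 0 1 = _
  decide +kernel

lemma slHom_S : slHom slS = w := by
  change bruhat 0 (-1) 1 0 = _
  decide +kernel

lemma slHom_ker : slHom.ker = Subgroup.center (SpecialLinearGroup (Fin 2) (ZMod 7)) := by
  ext A
  rw [MonoidHom.mem_ker, Matrix.SpecialLinearGroup.mem_center_iff, slHom_apply]
  constructor
  · intro h
    have hdet := A.det_coe
    rw [det_fin_two] at hdet
    obtain ⟨h01, h10, h00, h11⟩ := eq_of_bruhat_eq_one _ _ _ _ hdet h
    refine ⟨A 0 0, by rw [Fintype.card_fin, pow_two, h00], ?_⟩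
    ext i j
    fin_cases i <;> fin_cases j <;> simp [h01, h10, h11]
  · rintro ⟨r, hr, h⟩
    have hA : ∀ i j, A i j = Matrix.scalar (Fin 2) r i j := fun i j => by rw [h]
    rw [hA, hA, hA, hA]
    simpa using bruhat_scalar r (by rwa [Fintype.card_fin, pow_two] at hr)

lemma slHom_range : slHom.range = sig.range := by
  refine le_antisymm ?_ ?_
  · rw [MonoidHom.range_eq_map, ← sl_closure, MonoidHom.map_closure, Subgroup.closure_le]
    rintro _ ⟨_, rfl | rfl, rfl⟩
    · exact ⟨ga, by rw [slHom_T, sig_ga]⟩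
    · exact ⟨gt ^ 2, by rw [slHom_S, map_pow, sig_gt, w]⟩
  · rw [MonoidHom.range_eq_map sig, ← Gam_closure, MonoidHom.map_closure, Subgroup.closure_le]
    rintro _ ⟨_, rfl | rfl | rfl, rfl⟩
    · exact ⟨slT 1, by rw [slHom_T, sig_ga]⟩
    · refine ⟨⟨!![1, 6; 2, 6], by decide +kernel⟩, ?_⟩
      rw [sig_gc]
      change bruhat 1 6 2 6 = _
      decide +kernel
    · refine ⟨⟨!![2, 5; 2, 2], by decide +kernel⟩, ?_⟩
      rw [sig_gt]
      change bruhat 2 5 2 2 = _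
      decide +kernel

/-- The isomorphism of `PSL₂(7)` with the group of permutations of the points induced by `Gam`. -/
def pslEquiv : PSL(2, ZMod 7) ≃* sig.range :=
  ((QuotientGroup.quotientMulEquivOfEq slHom_ker.symm).trans
    (QuotientGroup.quotientKerEquivRange slHom)).trans (MulEquiv.subgroupCongr slHom_range)

lemma Gam_nonsplit : IsNonsplitExt (D.subgroupOf Gam) PSL(2, ZMod 7) := by
  refine isNonsplitExt_of_pow_ne_one ((pslEquiv.symm : _ →* PSL(2, ZMod 7)).comp sig.rangeRestrict)
    (pslEquiv.symm.surjective.comp sig.rangeRestrict_surjective) ?_ gt 4 ?_ fun x hx => ?_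
  · rw [MonoidHom.ker_mulEquiv_comp, MonoidHom.ker_rangeRestrict, D_subgroupOf_Gam]
  · rw [← map_pow]
    have : sig.rangeRestrict (gt ^ 4) = 1 := Subtype.ext (by
      change sig (gt ^ 4) = 1
      rw [map_pow, sig_gt]
      decide +kernel)
    rw [MonoidHom.comp_apply, this, map_one]
  · exact pow_four_ne_one_of_sig_eq (congrArg Subtype.val (pslEquiv.symm.injective hx))

/-- The permutations induced by `Gam` are generated by those of `α` and `θ²`. -/
lemma sig_mem_of_mem {H : Subgroup (Equiv.Perm (Fin 8))} (ha : a.perm ∈ H) (hw : w ∈ H) (g : Gam) :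
    sig g ∈ H := by
  have h : slHom.range ≤ H := by
    rw [MonoidHom.range_eq_map, ← sl_closure, MonoidHom.map_closure, Subgroup.closure_le]
    rintro _ ⟨_, rfl | rfl, rfl⟩
    · rwa [slHom_T]
    · rwa [slHom_S]
  exact h (slHom_range ▸ ⟨g, rfl⟩)

/-- The Bruhat decomposition of `Gam / D`. -/
lemma sig_bruhat (g : Gam) : (∃ i j : ℕ, sig g = b.perm ^ i * a.perm ^ j) ∨
    ∃ (i j : ℕ) (k : Fin 3), sig g = a.perm ^ i * w * b.perm ^ (k : ℕ) * a.perm ^ j := by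
  obtain ⟨A, hA⟩ : sig g ∈ slHom.range := slHom_range ▸ ⟨g, rfl⟩
  rw [← hA, slHom_apply, bruhat]
  split_ifs
  · exact Or.inl ⟨_, _, rfl⟩
  · have h : log3 (A 1 0) < 3 := by unfold log3; split_ifs <;> omega
    exact Or.inr ⟨_, _, ⟨_, h⟩, rfl⟩

end

/-! ### The maximal subgroups -/

lemma mem_of_sig_eq {H : Subgroup Gam} (hD : D.subgroupOf Gam ≤ H) {x g : Gam} (hx : x ∈ H)
    (h : sig g = sig x) : g ∈ H := by
  have h1 : g * x⁻¹ ∈ H := hD (by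
    rw [D_subgroupOf_Gam, MonoidHom.mem_ker, map_mul, map_inv, h, mul_inv_cancel])
  simpa using mul_mem h1 hx

instance : Finite Gam := Nat.finite_of_card_ne_zero (by rw [card_Gam]; norm_num)

/-- `D` is a minimal normal subgroup: conjugation by `α` permutes its nontrivial elements
transitively. -/
lemma D_minimal (N : Subgroup Gam) (hN : N.Normal) (hle : N ≤ D.subgroupOf Gam) :
    N = ⊥ ∨ N = D.subgroupOf Gam := by
  by_cases h : N = ⊥
  · exact Or.inl h
  refine Or.inr (le_antisymm hle fun d hd => ?_)
  obtain ⟨⟨x, hx⟩, hx1⟩ := Subgroup.ne_bot_iff_exists_ne_one.1 h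
  have hx1 : x ≠ 1 := fun h => hx1 (Subtype.ext h)
  have key : ∀ i j k i' j' k' : Fin 2, diag i j k ≠ 1 → diag i' j' k' ≠ 1 →
      ∃ n : Fin 7, a ^ (n : ℕ) * diag i j k = diag i' j' k' * a ^ (n : ℕ) := by decide +kernel
  by_cases hd1 : d = 1
  · rw [hd1]; exact one_mem _
  obtain ⟨i, j, k, h1⟩ := mem_D_iff_diag.1 (hle hx)
  obtain ⟨i', j', k', h2⟩ := mem_D_iff_diag.1 hd
  replace h1 := code_eq_iff.2 h1
  replace h2 := code_eq_iff.2 h2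
  obtain ⟨n, hn⟩ := key i j k i' j' k' (by rwa [← h1, map_ne_one_iff code code_injective])
    (by rwa [← h2, map_ne_one_iff code code_injective])
  have h3 : d = ga ^ (n : ℕ) * x * (ga ^ (n : ℕ))⁻¹ := by
    rw [eq_mul_inv_iff_mul_eq]
    refine code_injective ?_
    rw [map_mul, map_mul, map_pow, code_ga, h1, h2, hn]
  rw [h3]
  exact hN.conj_mem _ hx _

lemma D_le_of_isCoatom {H : Subgroup Gam} (hH : IsCoatom H) : D.subgroupOf Gam ≤ H := by
  have hn : (D.subgroupOf Gam).Normal := by rw [D_subgroupOf_Gam]; infer_instance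
  refine le_of_isCoatom hH (fun x hx y hy => ?_) D_minimal Gam_nonsplit.2
  have hinv : ∀ z : Gam, z ∈ D.subgroupOf Gam → z⁻¹ = z := fun z hz =>
    inv_eq_of_mul_eq_one_left (Subtype.ext (mul_self_of_mem_D hz))
  rw [← hinv _ (mul_mem hx hy), mul_inv_rev, hinv _ hx, hinv _ hy]

/-- The labelling of the indices by the vectors of `𝔽₂³` for which collinear points have sum
zero. -/
def vec (i : Fin 8) : Fin 3 → ZMod 2 :=
  ![((relabel i : Fin 8) : ℕ), (((relabel i : Fin 8) : ℕ) / 2 : ℕ),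
    (((relabel i : Fin 8) : ℕ) / 4 : ℕ)]

lemma vec_bijective : Function.Bijective vec := by
  rw [Fintype.bijective_iff_injective_and_card]
  exact ⟨by decide +kernel, by simp⟩

lemma vec_idx : ∀ i j, vec (idx i j) = vec i + vec j := by decide +kernel

/-- An element of `Gam` acts linearly on the labels. -/
lemma exists_addHom (g : Gam) : ∃ A : (Fin 3 → ZMod 2) →+ (Fin 3 → ZMod 2),
    ∀ i, A (vec i) = vec (sig g i) := by
  let E := Equiv.ofBijective vec vec_bijective
  refine ⟨AddMonoidHom.mk' (fun v => vec (sig g (E.symm v))) fun u v => ?_, fun i => ?_⟩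
  · obtain ⟨i, rfl⟩ := E.surjective u
    obtain ⟨j, rfl⟩ := E.surjective v
    have h : E i + E j = E (idx i j) := (vec_idx i j).symm
    rw [h]
    simp only [Equiv.symm_apply_apply]
    rw [sig_idx, vec_idx]
  · change vec (sig g (E.symm (E i))) = _
    rw [Equiv.symm_apply_apply]

/-- A nonempty set of at most three points determines an invariant point, namely the sum of its
elements, unless it is a line. -/
lemma exists_fixed_or_line (S : Finset (Fin 8)) (h0 : 0 ∉ S) (hne : S.Nonempty) (hc : S.card ≤ 3) :
    (∃ p, p ≠ 0 ∧ ∀ g : Gam, S.image (sig g) = S → sig g p = p) ∨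
      ∃ k : Fin 7, S = ({2, 4, 6} : Finset (Fin 8)).image (a.perm ^ (k : ℕ)) := by
  obtain ⟨p, hp⟩ := vec_bijective.2 (∑ i ∈ S, vec i)
  by_cases hp0 : p = 0
  · right
    have hv0 : vec 0 = 0 := by decide
    rw [hp0, hv0] at hp
    have h2 : ∀ i j, vec i + vec j = 0 → i = j := by decide +kernel
    have h3 : ∀ i j k : Fin 8, i ≠ 0 → j ≠ 0 → k ≠ 0 → i ≠ j → i ≠ k → j ≠ k →
        vec i + (vec j + vec k) = 0 → ∃ n : Fin 7, ({i, j, k} : Finset (Fin 8)) =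
          ({2, 4, 6} : Finset (Fin 8)).image (a.perm ^ (n : ℕ)) := by decide +kernel
    have hpos := hne.card_pos
    have : S.card = 1 ∨ S.card = 2 ∨ S.card = 3 := by omega
    rcases this with h | h | h
    · obtain ⟨i, rfl⟩ := Finset.card_eq_one.1 h
      rw [Finset.sum_singleton, ← hv0] at hp
      exact absurd (vec_bijective.1 hp) (by simpa using h0)
    · obtain ⟨i, j, hij, rfl⟩ := Finset.card_eq_two.1 h
      rw [Finset.sum_pair hij] at hp
      exact absurd (h2 i j hp.symm) hij
    · obtain ⟨i, j, k, hij, hik, hjk, rfl⟩ := Finset.card_eq_three.1 h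
      rw [Finset.sum_insert (by simp [hij, hik]), Finset.sum_pair hjk] at hp
      simp only [Finset.mem_insert, Finset.mem_singleton, not_or] at h0
      exact h3 i j k (Ne.symm h0.1) (Ne.symm h0.2.1) (Ne.symm h0.2.2) hij hik hjk hp.symm
  · refine Or.inl ⟨p, hp0, fun g hg => vec_bijective.1 ?_⟩
    obtain ⟨A, hA⟩ := exists_addHom g
    rw [← hA, hp, map_sum]
    conv_rhs => rw [← hg, Finset.sum_image (sig g).injective.injOn]
    exact Finset.sum_congr rfl fun i _ => hA i

lemma mem_map_conj_iff {H : Subgroup Gam} {g x : Gam} :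
    x ∈ H.map (MulAut.conj g).toMonoidHom ↔ g⁻¹ * x * g ∈ H := by
  constructor
  · rintro ⟨y, hy, rfl⟩
    simpa [mul_assoc] using hy
  · intro h
    exact ⟨_, h, by simp [mul_assoc]⟩

lemma le_conj_M2 {H : Subgroup Gam} {p : Fin 8} (hp : p ≠ 0) (h : ∀ g ∈ H, sig g p = p) :
    ∃ x : Gam, H ≤ (M2.subgroupOf Gam).map (MulAut.conj x).toMonoidHom := by
  obtain ⟨k, hk⟩ := exists_pow_a p hp
  have hk' : sig (ga ^ (k : ℕ)) 6 = p := by rw [map_pow, sig_ga, hk]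
  refine ⟨ga ^ (k : ℕ), fun g hg => mem_map_conj_iff.2 ?_⟩
  rw [Subgroup.mem_subgroupOf, mem_M2_iff, map_mul, map_mul, Equiv.Perm.mul_apply,
    Equiv.Perm.mul_apply, hk', h g hg, map_inv, ← hk']
  exact Equiv.symm_apply_apply _ _

lemma le_conj_M3 {H : Subgroup Gam} {k : ℕ}
    (h : ∀ g ∈ H, (({2, 4, 6} : Finset (Fin 8)).image (a.perm ^ k)).image (sig g) =
      ({2, 4, 6} : Finset (Fin 8)).image (a.perm ^ k)) :
    ∃ x : Gam, H ≤ (M3.subgroupOf Gam).map (MulAut.conj x).toMonoidHom := by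
  refine ⟨ga ^ k, fun g hg => mem_map_conj_iff.2 ?_⟩
  rw [Subgroup.mem_subgroupOf, mem_M3_iff]
  set y := (ga ^ k)⁻¹ * g * ga ^ k
  have hy : ({2, 4, 6} : Finset (Fin 8)).image (sig y) = {2, 4, 6} := by
    have h1 := congrArg (Finset.image (sig (ga ^ k)⁻¹)) (h g hg)
    rw [← sig_ga, ← map_pow, Finset.image_image, Finset.image_image, Finset.image_image] at h1
    have h2 : (sig (ga ^ k)⁻¹ : Fin 8 → Fin 8) ∘ sig (ga ^ k) = id := by
      rw [← Equiv.Perm.coe_mul, ← map_mul, inv_mul_cancel, map_one, Equiv.Perm.coe_one]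
    have h3 : (sig (ga ^ k)⁻¹ : Fin 8 → Fin 8) ∘ (sig g : Fin 8 → Fin 8) ∘ sig (ga ^ k) =
        sig y := by
      rw [← Equiv.Perm.coe_mul, ← Equiv.Perm.coe_mul, ← map_mul, ← map_mul, ← mul_assoc]
    rwa [h2, Function.comp_assoc, h3, Finset.image_id] at h1
  have hoff : ∀ i : Fin 8, i ∈ offLine ↔ i ≠ 0 ∧ i ∉ ({2, 4, 6} : Finset (Fin 8)) := by decide
  intro i
  have h4 : sig y i ∈ ({2, 4, 6} : Finset (Fin 8)) ↔ i ∈ ({2, 4, 6} : Finset (Fin 8)) := by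
    conv_lhs => rw [← hy]
    simp only [Finset.mem_image, (sig y).injective.eq_iff, exists_eq_right]
  have h5 : sig y i ≠ 0 ↔ i ≠ 0 := by
    rw [not_iff_not]
    exact ⟨fun h => (sig y).injective (h.trans (sig_zero y).symm), fun h => by rw [h, sig_zero]⟩
  rw [hoff, hoff, h4, h5]

/-! ### The group `2³:7:3` -/

lemma alpha_mem_M1 : alpha ∈ M1 := Subgroup.subset_closure (by simp)

lemma beta_mem_M1 : beta ∈ M1 := Subgroup.subset_closure (by simp)

lemma N1_mem_M1 : N1 ∈ M1 := Subgroup.subset_closure (by simp)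

lemma alpha_mem_F21 : alpha ∈ F21 := Subgroup.subset_closure (by simp)

lemma beta_mem_F21 : beta ∈ F21 := Subgroup.subset_closure (by simp)

lemma F21_le_M1 : F21 ≤ M1 := (Subgroup.closure_le _).2 (by
  rintro _ (rfl | rfl)
  exacts [alpha_mem_M1, beta_mem_M1])

lemma D_le_M1 : D ≤ M1 := by
  have key : ∀ n : ℕ, toLin (a ^ n * n1 * (a ^ n)⁻¹) ∈ M1 := fun n => by
    simp only [map_mul, map_inv, map_pow, toLin_a, toLin_n1]
    exact mul_mem (mul_mem (pow_mem alpha_mem_M1 _) N1_mem_M1) (inv_mem (pow_mem alpha_mem_M1 _))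
  have h2 : ∃ n : Fin 7, n2 = a ^ (n : ℕ) * n1 * (a ^ (n : ℕ))⁻¹ := by decide +kernel
  have h7 : ∃ n : Fin 7, n7 = a ^ (n : ℕ) * n1 * (a ^ (n : ℕ))⁻¹ := by decide +kernel
  refine (Subgroup.closure_le _).2 ?_
  rintro _ (rfl | rfl | rfl)
  · exact N1_mem_M1
  · obtain ⟨n, hn⟩ := h2
    rw [← toLin_n2, hn]; exact key n
  · obtain ⟨n, hn⟩ := h7
    rw [← toLin_n7, hn]; exact key n

lemma M1_le_Gam : M1 ≤ Gam := (Subgroup.closure_le _).2 (by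
  rintro _ (rfl | rfl | rfl)
  exacts [ga.2, gb.2, D_le_Gam N1_mem_D])

lemma conj_mem_D {g d : Oct ≃ₗ[ℝ] Oct} (hg : g ∈ Gam) (hd : d ∈ D) : g * d * g⁻¹ ∈ D := by
  have h : sig (⟨g, hg⟩ * ⟨d, D_le_Gam hd⟩ * ⟨g, hg⟩⁻¹) = 1 := by
    rw [map_mul, map_mul, sig_eq_one_iff (g := ⟨d, D_le_Gam hd⟩).2 hd, mul_one, map_inv,
      mul_inv_cancel]
  exact sig_eq_one_iff.1 h

lemma orderOf_a : orderOf a = 7 :=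
  have := fact_prime_seven
  orderOf_eq_prime (by decide +kernel) (by decide +kernel)

lemma orderOf_alpha : orderOf alpha = 7 := by
  rw [← toLin_a, orderOf_injective toLin toLin_injective, orderOf_a]

lemma orderOf_b : orderOf b = 3 :=
  orderOf_eq_prime (by decide +kernel) (by decide +kernel)

lemma orderOf_beta : orderOf beta = 3 := by
  rw [← toLin_b, orderOf_injective toLin toLin_injective, orderOf_b]

lemma mem_zpowers_toLin {x : SPerm} {n : ℕ} (hn : orderOf x = n) [NeZero n]
    {g : Oct ≃ₗ[ℝ] Oct} : g ∈ Subgroup.zpowers (toLin x) ↔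
      ∃ i : Fin n, g = toLin (x ^ (i : ℕ)) := by
  have hn' : orderOf (toLin x) = n := by rw [orderOf_injective toLin toLin_injective, hn]
  constructor
  · intro h
    have hfin : IsOfFinOrder (toLin x) := by
      rw [← orderOf_pos_iff, hn']; exact Nat.pos_of_neZero n
    obtain ⟨i, rfl⟩ := hfin.mem_powers_iff_mem_zpowers.2 h
    refine ⟨⟨i % n, Nat.mod_lt _ (Nat.pos_of_neZero n)⟩, ?_⟩
    rw [map_pow]
    exact (pow_mod_orderOf (toLin x) i).symm.trans (by rw [hn'])
  · rintro ⟨i, rfl⟩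
    rw [map_pow]
    exact Subgroup.npow_mem_zpowers _ _

/-- `7:3` is the semidirect product of `⟨α⟩` and `⟨β⟩`. -/
lemma F21_isComplement : ((Subgroup.zpowers alpha).subgroupOf F21).Normal ∧
    ((Subgroup.zpowers alpha).subgroupOf F21).IsComplement'
      ((Subgroup.zpowers beta).subgroupOf F21) := by
  refine isComplement_sup ?_ ?_ ?_
  · rw [F21, Subgroup.zpowers_eq_closure, Subgroup.zpowers_eq_closure, ← Subgroup.closure_union]
    rfl
  · have key : ∀ (i : Fin 7) (j : Fin 3), ∃ k : Fin 7,
        b ^ (j : ℕ) * a ^ (i : ℕ) * (b ^ (j : ℕ))⁻¹ = a ^ (k : ℕ) := by decide +kernel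
    rintro c hc x hx
    obtain ⟨j, rfl⟩ := (mem_zpowers_toLin orderOf_b).1 hc
    obtain ⟨i, rfl⟩ := (mem_zpowers_toLin orderOf_a).1 hx
    obtain ⟨k, hk⟩ := key i j
    refine (mem_zpowers_toLin orderOf_a).2 ⟨k, ?_⟩
    rw [← hk, map_mul, map_mul, map_inv]
  · have key : ∀ (i : Fin 7) (j : Fin 3), a ^ (i : ℕ) = b ^ (j : ℕ) → a ^ (i : ℕ) = 1 := by
      decide +kernel
    rw [Subgroup.eq_bot_iff_forall]
    rintro x ⟨h1, h2⟩
    obtain ⟨i, rfl⟩ := (mem_zpowers_toLin orderOf_a).1 h1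
    obtain ⟨j, hj⟩ := (mem_zpowers_toLin orderOf_b).1 h2
    rw [key i j (toLin_injective hj), map_one]

lemma zpowers_alpha_le : Subgroup.zpowers alpha ≤ F21 := by
  rw [Subgroup.zpowers_le]; exact alpha_mem_F21

lemma zpowers_beta_le : Subgroup.zpowers beta ≤ F21 := by
  rw [Subgroup.zpowers_le]; exact beta_mem_F21

lemma card_F21 : Nat.card F21 = 21 := by
  rw [← F21_isComplement.2.card_mul_card,
    Nat.card_congr (Subgroup.subgroupOfEquivOfLe zpowers_alpha_le).toEquiv,
    Nat.card_congr (Subgroup.subgroupOfEquivOfLe zpowers_beta_le).toEquiv,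
    Nat.card_zpowers, Nat.card_zpowers, orderOf_alpha, orderOf_beta]

lemma exists_of_mem_F21 {g : Oct ≃ₗ[ℝ] Oct} (hg : g ∈ F21) :
    ∃ (i : Fin 7) (j : Fin 3), g = toLin (a ^ (i : ℕ) * b ^ (j : ℕ)) := by
  have h : (⟨g, hg⟩ : F21) ∈ ((Subgroup.zpowers alpha).subgroupOf F21 : Set F21) *
      ((Subgroup.zpowers beta).subgroupOf F21 : Set F21) := by
    rw [F21_isComplement.2.mul_eq]; trivial
  obtain ⟨x, hx, y, hy, hxy⟩ := h
  obtain ⟨i, hi⟩ := (mem_zpowers_toLin orderOf_a).1 hx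
  obtain ⟨j, hj⟩ := (mem_zpowers_toLin orderOf_b).1 hy
  refine ⟨i, j, ?_⟩
  rw [map_mul, ← hi, ← hj]
  exact (congrArg Subtype.val hxy).symm

lemma D_inf_F21 : D ⊓ F21 = ⊥ := by
  have key : ∀ (i : Fin 7) (j : Fin 3), (a ^ (i : ℕ) * b ^ (j : ℕ)).perm = 1 →
      a ^ (i : ℕ) * b ^ (j : ℕ) = 1 := by decide +kernel
  rw [Subgroup.eq_bot_iff_forall]
  rintro x ⟨h1, h2⟩
  obtain ⟨i, j, rfl⟩ := exists_of_mem_F21 h2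
  obtain ⟨i', j', k', h⟩ := mem_D_iff_diag.1 h1
  have h3 := toLin_injective h
  rw [key i j (by rw [h3, diag_perm]), map_one]

/-- `M₁` is the semidirect product of `D` and `⟨α, β⟩`. -/
lemma M1_isComplement : (D.subgroupOf M1).Normal ∧
    (D.subgroupOf M1).IsComplement' (F21.subgroupOf M1) := by
  refine isComplement_sup (le_antisymm ?_ (sup_le D_le_M1 F21_le_M1))
    (fun c hc x hx => conj_mem_D (M1_le_Gam (F21_le_M1 hc)) hx) D_inf_F21
  refine (Subgroup.closure_le _).2 ?_
  rintro _ (rfl | rfl | rfl)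
  · exact (le_sup_right : _ ≤ D ⊔ F21) alpha_mem_F21
  · exact (le_sup_right : _ ≤ D ⊔ F21) beta_mem_F21
  · exact (le_sup_left : _ ≤ D ⊔ F21) N1_mem_D

lemma card_M1 : Nat.card M1 = 168 := by
  rw [← M1_isComplement.2.card_mul_card,
    Nat.card_congr (Subgroup.subgroupOfEquivOfLe D_le_M1).toEquiv,
    Nat.card_congr (Subgroup.subgroupOfEquivOfLe F21_le_M1).toEquiv, card_D, card_F21]

lemma exists_of_mem_M1 {g : Oct ≃ₗ[ℝ] Oct} (hg : g ∈ M1) :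
    ∃ (p q r : Fin 2) (i : Fin 7) (j : Fin 3),
      g = toLin (diag p q r * (a ^ (i : ℕ) * b ^ (j : ℕ))) := by
  have h : (⟨g, hg⟩ : M1) ∈ (D.subgroupOf M1 : Set M1) * (F21.subgroupOf M1 : Set M1) := by
    rw [M1_isComplement.2.mul_eq]; trivial
  obtain ⟨x, hx, y, hy, hxy⟩ := h
  obtain ⟨p, q, r, hd⟩ := mem_D_iff_diag.1 hx
  obtain ⟨i, j, hf⟩ := exists_of_mem_F21 hy
  refine ⟨p, q, r, i, j, ?_⟩
  rw [map_mul, ← hf, ← hd]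
  exact (congrArg Subtype.val hxy).symm

/-! ### Subgroups that permute the points transitively -/

lemma mem_M1_of_sig {g : Gam} {i j : ℕ} (h : sig g = b.perm ^ i * a.perm ^ j) : g.1 ∈ M1 := by
  refine mem_of_sig_eq (H := M1.subgroupOf Gam) (fun x hx => D_le_M1 hx) (x := gb ^ i * ga ^ j)
    ?_ (by rw [h]; simp)
  exact mul_mem (pow_mem (show gb ∈ M1.subgroupOf Gam from beta_mem_M1) _)
    (pow_mem (show ga ∈ M1.subgroupOf Gam from alpha_mem_M1) _)

/-- A subgroup that contains `D` and `α` and is not contained in `M₁` is the whole group: by the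
Bruhat decomposition it contains, modulo `D`, an element `w * β ^ k`, and a power of `β`
conjugates this element to `w` and `⟨α⟩` to itself. -/
lemma eq_top_of_not_le_M1 {H : Subgroup Gam} (hD : D.subgroupOf Gam ≤ H) (ha : ga ∈ H)
    (hM : ¬ H ≤ M1.subgroupOf Gam) : H = ⊤ := by
  obtain ⟨g, hg, hgM⟩ := SetLike.not_le_iff_exists.1 hM
  rcases sig_bruhat g with ⟨i, j, h⟩ | ⟨i, j, k, h⟩
  · exact absurd (mem_M1_of_sig h) hgM
  have haH : a.perm ∈ H.map sig := ⟨ga, ha, sig_ga⟩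
  have hwH : w * b.perm ^ (k : ℕ) ∈ H.map sig := by
    have h1 : sig g ∈ H.map sig := ⟨g, hg, rfl⟩
    rw [h, mul_assoc, mul_assoc, Subgroup.mul_mem_cancel_left _ (pow_mem haH i), ← mul_assoc,
      Subgroup.mul_mem_cancel_right _ (pow_mem haH j)] at h1
    exact h1
  have key1 : ∀ k : Fin 3, ∃ n : Fin 7,
      (b.perm ^ (2 * k : ℕ))⁻¹ * a.perm * b.perm ^ (2 * k : ℕ) = a.perm ^ (n : ℕ) := by
    decide +kernel
  have key2 : ∀ k : Fin 3,
      (b.perm ^ (2 * k : ℕ))⁻¹ * w * b.perm ^ (2 * k : ℕ) = w * b.perm ^ (k : ℕ) := by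
    decide +kernel
  have hall : ∀ q : Gam, sig q ∈ H.map sig := by
    intro q
    obtain ⟨x, hx⟩ : ∃ x, sig x = b.perm ^ (2 * k : ℕ) := ⟨gb ^ (2 * k : ℕ), by simp⟩
    have hc : ∀ y, y ∈ (H.map sig).comap (MulAut.conj (sig x)⁻¹).toMonoidHom ↔
        (sig x)⁻¹ * y * sig x ∈ H.map sig := fun y => by
      rw [Subgroup.mem_comap, MulEquiv.coe_toMonoidHom, MulAut.conj_apply, inv_inv]
    obtain ⟨n, hn⟩ := key1 k
    have h2 := sig_mem_of_mem ((hc a.perm).2 (by rw [hx, hn]; exact pow_mem haH _))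
      ((hc w).2 (by rw [hx, key2]; exact hwH)) (x * q * x⁻¹)
    rw [hc, map_mul, map_mul, map_inv] at h2
    simpa only [mul_assoc, inv_mul_cancel_left, inv_mul_cancel, mul_one] using h2
  rw [eq_top_iff]
  rintro q -
  obtain ⟨y, hy, hyq⟩ := hall q
  exact mem_of_sig_eq hD hy hyq.symm

lemma D_le_map_conj {H : Subgroup Gam} (hD : D.subgroupOf Gam ≤ H) (x : Gam) :
    D.subgroupOf Gam ≤ H.map (MulAut.conj x).toMonoidHom := by
  intro d hd
  rw [mem_map_conj_iff]
  refine hD ?_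
  have h : (x⁻¹ * d * x⁻¹⁻¹).1 ∈ D := conj_mem_D (x⁻¹).2 hd
  rwa [inv_inv] at h

lemma le_map_conj_inv {H L : Subgroup Gam} {x : Gam}
    (h : H.map (MulAut.conj x).toMonoidHom ≤ L) :
    H ≤ L.map (MulAut.conj x⁻¹).toMonoidHom := by
  intro g hg
  rw [mem_map_conj_iff]
  exact h ⟨g, hg, by simp⟩

/-- All subgroups of order seven are conjugate to `⟨α⟩` by Sylow's theorem. -/
lemma le_conj_M1_of_dvd {H : Subgroup Gam} (hH : H ≠ ⊤) (hD : D.subgroupOf Gam ≤ H)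
    (h7 : 7 ∣ Nat.card H) :
    ∃ x : Gam, H ≤ (M1.subgroupOf Gam).map (MulAut.conj x).toMonoidHom := by
  have := fact_prime_seven
  have hfac : (Nat.card Gam).factorization 7 = 1 := by
    rw [card_Gam, Nat.factorization_def _ (by norm_num)]
    decide +kernel
  obtain ⟨P, hP⟩ := Sylow.exists_subgroup_card_pow_prime (G := H) 7 (n := 1) (by simpa using h7)
  have hP' : Nat.card (P.map H.subtype) = 7 ^ (Nat.card Gam).factorization 7 := by
    rw [Subgroup.card_map_of_injective H.subtype_injective, hP, hfac]
  have hord : orderOf ga = 7 := by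
    rw [← orderOf_injective code code_injective, code_ga, orderOf_a]
  have hQ : Nat.card (Subgroup.zpowers ga) = 7 ^ (Nat.card Gam).factorization 7 := by
    rw [Nat.card_zpowers, hord, hfac, pow_one]
  obtain ⟨x, hx⟩ := MulAction.exists_smul_eq Gam (Sylow.ofCard _ hP') (Sylow.ofCard _ hQ)
  have hx' : (P.map H.subtype).map (MulAut.conj x).toMonoidHom = Subgroup.zpowers ga :=
    congrArg Sylow.toSubgroup hx
  have hga : ga ∈ H.map (MulAut.conj x).toMonoidHom := by
    refine Subgroup.map_mono (Subgroup.map_subtype_le P) ?_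
    rw [hx']; exact Subgroup.mem_zpowers _
  refine ⟨x⁻¹, le_map_conj_inv ?_⟩
  by_contra hM
  have htop := eq_top_of_not_le_M1 (D_le_map_conj hD x) hga hM
  refine hH (eq_top_iff.2 fun g _ => ?_)
  have h1 : x * g * x⁻¹ ∈ H.map (MulAut.conj x).toMonoidHom := by rw [htop]; trivial
  rw [mem_map_conj_iff] at h1
  simpa [mul_assoc] using h1

/-! ### The classification of the maximal subgroups -/

/-- A proper subgroup containing `D` fixes a point or a line of the Fano plane, or permutes the
points transitively; in each case it is contained in a conjugate of one of the three groups. -/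
lemma le_conj_of_ne_top {H : Subgroup Gam} (hH : H ≠ ⊤) (hD : D.subgroupOf Gam ≤ H) :
    ∃ x : Gam, ∃ M ∈ ({M1.subgroupOf Gam, M2.subgroupOf Gam, M3.subgroupOf Gam} :
      Set (Subgroup Gam)), H ≤ M.map (MulAut.conj x).toMonoidHom := by
  classical
  let O : Finset (Fin 8) := Finset.univ.filter fun i => ∃ g ∈ H, sig g 1 = i
  have h1O : 1 ∈ O := Finset.mem_filter.2 ⟨Finset.mem_univ _, 1, one_mem _, by simp⟩
  have hne0 : ∀ (g : Gam) (i : Fin 8), sig g i = 0 ↔ i = 0 := fun g i =>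
    ⟨fun h => (sig g).injective (h.trans (sig_zero g).symm), fun h => by rw [h, sig_zero]⟩
  have h0O : 0 ∉ O := by
    intro h
    obtain ⟨-, g, -, hg⟩ := Finset.mem_filter.1 h
    exact absurd ((hne0 g 1).1 hg) (by decide)
  have hinv : ∀ S : Finset (Fin 8), (∀ g ∈ H, ∀ i ∈ S, sig g i ∈ S) →
      ∀ g ∈ H, S.image (sig g) = S := fun S hS g hg =>
    Finset.eq_of_subset_of_card_le (Finset.image_subset_iff.2 (hS g hg))
      (Finset.card_image_of_injective _ (sig g).injective).ge
  have hO : ∀ g ∈ H, ∀ i ∈ O, sig g i ∈ O := by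
    rintro g hg i hi
    obtain ⟨-, x, hx, rfl⟩ := Finset.mem_filter.1 hi
    exact Finset.mem_filter.2 ⟨Finset.mem_univ _, g * x, mul_mem hg hx, by simp⟩
  -- an invariant set of at most three points leads to a fixed point or a fixed line
  have small : ∀ S : Finset (Fin 8), 0 ∉ S → S.Nonempty → S.card ≤ 3 →
      (∀ g ∈ H, ∀ i ∈ S, sig g i ∈ S) → ∃ x : Gam, ∃ M ∈ ({M1.subgroupOf Gam, M2.subgroupOf Gam,
        M3.subgroupOf Gam} : Set (Subgroup Gam)), H ≤ M.map (MulAut.conj x).toMonoidHom := by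
    intro S h0 hne hc hS
    rcases exists_fixed_or_line S h0 hne hc with ⟨p, hp, hfix⟩ | ⟨k, rfl⟩
    · obtain ⟨x, hx⟩ := le_conj_M2 hp fun g hg => hfix g (hinv S hS g hg)
      exact ⟨x, _, by simp, hx⟩
    · obtain ⟨x, hx⟩ := le_conj_M3 (hinv _ hS)
      exact ⟨x, _, by simp, hx⟩
  have hsub : O ⊆ Finset.univ.erase 0 := fun i hi =>
    Finset.mem_erase.2 ⟨fun h => h0O (h ▸ hi), Finset.mem_univ _⟩
  have hcard : (Finset.univ.erase (0 : Fin 8) \ O).card = 7 - O.card := by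
    rw [Finset.card_sdiff_of_subset hsub]; rfl
  by_cases hc : O.card ≤ 3
  · exact small O h0O ⟨1, h1O⟩ hc hO
  by_cases hfull : O = Finset.univ.erase 0
  · let _ : MulAction H (Fin 8) := MulAction.compHom (Fin 8) (sig.comp H.subtype)
    have horb : MulAction.orbit H (1 : Fin 8) = (O : Set (Fin 8)) := by
      ext i
      simp only [O, Finset.coe_filter, Finset.mem_univ, true_and, Set.mem_ofPred_eq]
      exact ⟨fun ⟨g, hg⟩ => ⟨g.1, g.2, hg⟩, fun ⟨g, hg, hi⟩ => ⟨⟨g, hg⟩, hi⟩⟩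
    have h7 : 7 ∣ Nat.card H := by
      have h := Subgroup.index_dvd_card (MulAction.stabilizer H (1 : Fin 8))
      rw [MulAction.index_stabilizer, horb, Set.ncard_coe_finset, hfull] at h
      exact h
    obtain ⟨x, hx⟩ := le_conj_M1_of_dvd hH hD h7
    exact ⟨x, _, by simp, hx⟩
  · refine small (Finset.univ.erase 0 \ O) (by simp) ?_ (by omega) fun g hg i hi => ?_
    · rw [Finset.sdiff_nonempty]
      exact fun h => hfull (hsub.antisymm h)
    · rw [Finset.mem_sdiff, Finset.mem_erase] at hi ⊢
      refine ⟨⟨fun h => hi.1.1 ((hne0 g i).1 h), Finset.mem_univ _⟩, fun h => hi.2 ?_⟩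
      simpa using hO g⁻¹ (inv_mem hg) _ h

lemma card_map_conj (M : Subgroup Gam) (x : Gam) :
    Nat.card (M.map (MulAut.conj x).toMonoidHom) = Nat.card M :=
  Subgroup.card_map_of_injective (MulAut.conj x).injective

lemma card_D_le_of_mem {M : Subgroup Gam} (hM : M ∈ ({M1.subgroupOf Gam, M2.subgroupOf Gam,
    M3.subgroupOf Gam} : Set (Subgroup Gam))) :
    D.subgroupOf Gam ≤ M ∧ (Nat.card M = 168 ∨ Nat.card M = 192) := by
  rcases hM with rfl | rfl | rfl
  · exact ⟨fun x hx => D_le_M1 hx, Or.inl (by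
      rw [Nat.card_congr (Subgroup.subgroupOfEquivOfLe M1_le_Gam).toEquiv, card_M1])⟩
  · exact ⟨fun x hx => D_le_M2 hx, Or.inr (by
      rw [Nat.card_congr (Subgroup.subgroupOfEquivOfLe M2_le_Gam).toEquiv, card_M2])⟩
  · exact ⟨fun x hx => D_le_M3 hx, Or.inr (by
      rw [Nat.card_congr (Subgroup.subgroupOfEquivOfLe M3_le_Gam).toEquiv, card_M3])⟩

lemma isCoatom_iff (H : Subgroup Gam) : IsCoatom H ↔ ∃ x : Gam, ∃ M ∈ ({M1.subgroupOf Gam,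
    M2.subgroupOf Gam, M3.subgroupOf Gam} : Set (Subgroup Gam)),
      H = M.map (MulAut.conj x).toMonoidHom := by
  have hne : ∀ L : Subgroup Gam, Nat.card L = 168 ∨ Nat.card L = 192 → L ≠ ⊤ := by
    rintro L hL rfl
    rw [Subgroup.card_top, card_Gam] at hL
    omega
  constructor
  · intro hH
    obtain ⟨x, M, hM, hle⟩ := le_conj_of_ne_top hH.1 (D_le_of_isCoatom hH)
    refine ⟨x, M, hM, ?_⟩
    rcases eq_or_lt_of_le hle with h | h
    · exact h
    · refine absurd (hH.2 _ h) (hne _ ?_)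
      rw [card_map_conj]
      exact (card_D_le_of_mem hM).2
  · rintro ⟨x, M, hM, rfl⟩
    obtain ⟨hDM, hcM⟩ := card_D_le_of_mem hM
    refine ⟨hne _ (by rwa [card_map_conj]), fun L hL => ?_⟩
    by_contra hLtop
    obtain ⟨y, M', hM', hle⟩ := le_conj_of_ne_top hLtop ((D_le_map_conj hDM x).trans hL.le)
    have hcM' := (card_D_le_of_mem hM').2
    have hlt := hL.trans_le hle
    have hdvd := Subgroup.card_dvd_of_le hlt.le
    have heq : Nat.card M' ≤ Nat.card M := by
      rw [card_map_conj, card_map_conj] at hdvd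
      rcases hcM with h | h <;> rcases hcM' with h' | h' <;> rw [h, h'] at hdvd ⊢ <;> omega
    refine hlt.ne (Subgroup.eq_of_le_of_card_ge hlt.le ?_)
    rwa [card_map_conj, card_map_conj]

lemma not_areConj_of_card_ne {H L : Subgroup Gam} (h : Nat.card H ≠ Nat.card L) :
    ¬ AreConj H L := by
  rintro ⟨g, rfl⟩
  exact h (card_map_conj _ _)

/-- `M₂` fixes a point of the Fano plane and `M₃` does not. -/
lemma not_areConj_M2_M3 : ¬ AreConj (M2.subgroupOf Gam) (M3.subgroupOf Gam) := by
  rintro ⟨g, hg⟩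
  have hfix : ∀ x : Gam, x.1 ∈ M3 → sig x (sig g⁻¹ 6) = sig g⁻¹ 6 := by
    intro x hx
    have h1 : g * x * g⁻¹ ∈ M2.subgroupOf Gam := by
      rw [hg]; exact ⟨x, hx, rfl⟩
    have h2 := (mem_M2_iff (g * x * g⁻¹)).1 h1
    rw [map_mul, map_mul, Equiv.Perm.mul_apply, Equiv.Perm.mul_apply] at h2
    apply (sig g).injective
    rw [h2, ← Equiv.Perm.mul_apply, ← map_mul, mul_inv_cancel, map_one, Equiv.Perm.one_apply]
  have key : ∀ p : Fin 8, b.perm p = p → (a.perm ^ 4 * t.perm * (a.perm ^ 4)⁻¹) p = p →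
      p = 0 := by decide +kernel
  have h1 := hfix gb ((mem_M3_iff gb).2 (by rw [sig_gb]; decide +kernel))
  have h2 := hfix gtLine gtLine_mem
  rw [sig_gb] at h1
  rw [sig_gtLine] at h2
  exact absurd ((sig g⁻¹).injective ((key _ h1 h2).trans (sig_zero _).symm)) (by decide)

/-! ### The structure of `7:3` -/

lemma F21_structure : ∃ C : Subgroup F21, Nonempty (C ≃* Multiplicative (ZMod 7)) ∧
    IsSplitExt C (Multiplicative (ZMod 3)) := by
  have := fact_prime_seven
  have h7 : Nat.card ((Subgroup.zpowers alpha).subgroupOf F21) = 7 := by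
    rw [Nat.card_congr (Subgroup.subgroupOfEquivOfLe zpowers_alpha_le).toEquiv, Nat.card_zpowers,
      orderOf_alpha]
  have h3 : Nat.card ((Subgroup.zpowers beta).subgroupOf F21) = 3 := by
    rw [Nat.card_congr (Subgroup.subgroupOfEquivOfLe zpowers_beta_le).toEquiv, Nat.card_zpowers,
      orderOf_beta]
  exact ⟨_, zpowers_equiv h7, F21_isComplement.1, _, F21_isComplement.2, zpowers_equiv h3⟩

lemma F21_not_comm : ¬ ∀ x y : F21, x * y = y * x := by
  intro h
  have h1 := congrArg Subtype.val (h ⟨alpha, alpha_mem_F21⟩ ⟨beta, beta_mem_F21⟩)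
  have h2 : toLin (a * b) = toLin (b * a) := by rw [map_mul, map_mul]; exact h1
  exact absurd (toLin_injective h2) (by decide +kernel)

/-! ### The representation on the imaginary octonions -/

lemma apply_eq_sum (g : Oct ≃ₗ[ℝ] Oct) (v : Oct) (i : Fin 8) :
    g v i = ∑ k, g (e k) i * v k := by
  have h : v = ∑ k, v k • e k := by
    ext j
    simp [e_apply]
  conv_lhs => rw [h, map_sum, Finset.sum_apply]
  exact Finset.sum_congr rfl fun k _ => by rw [map_smul, Pi.smul_apply, smul_eq_mul, mul_comm]

lemma apply_e_apply (g : Gam) (i j : Fin 8) :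
    g.1 (e j) i = if i = sig g j then (((code g).sign j : ℤ) : ℝ) else 0 := by
  rw [apply_e, Pi.smul_apply, e_apply]
  simp

lemma apply_e_succ_zero (g : Gam) (j : Fin 7) : g.1 (e j.succ) 0 = 0 := by
  rw [apply_e_apply, if_neg]
  intro h
  exact Fin.succ_ne_zero j ((sig g).injective (h.symm.trans (sig_zero g).symm))

/-- The matrix of an element of `Gam` on the imaginary octonions. -/
def imMatrix (g : Gam) : Matrix (Fin 7) (Fin 7) ℂ :=
  Matrix.of fun i j => ((g.1 (e j.succ) i.succ : ℝ) : ℂ)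

lemma imMatrix_mul (g h : Gam) : imMatrix (g * h) = imMatrix g * imMatrix h := by
  ext i j
  have h1 : (g * h).1 (e j.succ) i.succ =
      ∑ k : Fin 7, g.1 (e k.succ) i.succ * h.1 (e j.succ) k.succ := by
    change g.1 (h.1 (e j.succ)) i.succ = _
    rw [apply_eq_sum, Fin.sum_univ_succ, apply_e_succ_zero, mul_zero, zero_add]
  simp only [imMatrix, Matrix.mul_apply, Matrix.of_apply]
  rw [h1]
  push_cast
  rfl

lemma imMatrix_one : imMatrix 1 = 1 := by
  ext i j
  change ((e j.succ i.succ : ℝ) : ℂ) = _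
  rw [e_apply, Matrix.one_apply]
  simp [apply_ite]

/-- The complexified representation of `Gam` on the imaginary octonions. -/
def imRep : Representation ℂ Gam (Fin 7 → ℂ) where
  toFun g := Matrix.toLin' (imMatrix g)
  map_one' := by rw [imMatrix_one, Matrix.toLin'_one]; rfl
  map_mul' g h := by rw [imMatrix_mul, Matrix.toLin'_mul]; rfl

lemma imRep_single (g : Gam) (i j : Fin 7) :
    imRep g (Pi.single j 1) i = ((g.1 (e j.succ) i.succ : ℝ) : ℂ) := by
  change Matrix.toLin' (imMatrix g) _ _ = _
  rw [Matrix.toLin'_apply, Matrix.mulVec_single_one]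
  rfl

lemma imRep_diag {g : Gam} (hg : sig g = 1) (v : Fin 7 → ℂ) (i : Fin 7) :
    imRep g v i = (((code g).sign i.succ : ℤ) : ℂ) * v i := by
  change Matrix.toLin' (imMatrix g) _ _ = _
  rw [Matrix.toLin'_apply, Matrix.mulVec, dotProduct, Finset.sum_eq_single i]
  · simp [imMatrix, apply_e_apply, hg]
  · intro j _ hj
    simp [imMatrix, apply_e_apply, hg, hj.symm]
  · simp

/-- The trace of a signed permutation on the imaginary octonions. -/
def imTrace (x : SPerm) : ℤ :=
  ∑ i : Fin 7, if x.perm i.succ = i.succ then (x.sign i.succ : ℤ) else 0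

lemma imRep_trace (g : Gam) : LinearMap.trace ℂ _ (imRep g) = imTrace (code g) := by
  change LinearMap.trace ℂ _ (Matrix.toLin' (imMatrix g)) = _
  rw [Matrix.trace_toLin'_eq, Matrix.trace, imTrace]
  push_cast
  refine Finset.sum_congr rfl fun i _ => ?_
  simp only [Matrix.diag_apply, imMatrix, Matrix.of_apply, apply_e_apply, sig_apply]
  by_cases h : (code g).perm i.succ = i.succ
  · simp [h]
  · simp [h, Ne.symm h]

/-- The representation of `M₁` on the complexified imaginary octonions. -/
def M1Rep : Representation ℂ M1 (Fin 7 → ℂ) := imRep.comp (Subgroup.inclusion M1_le_Gam)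

/-- The seven coordinate lines afford distinct characters of `D`, so an invariant subspace contains
a coordinate line along which it has a nonzero vector; `α` permutes these lines transitively. -/
lemma M1Rep_irreducible : M1Rep.IsIrreducible := by
  have hnt : Nontrivial (Subrepresentation M1Rep) := by
    refine ⟨⟨⊥, ⊤, fun h => ?_⟩⟩
    have h1 : (⊥ : Submodule ℂ (Fin 7 → ℂ)) = ⊤ := congrArg Subrepresentation.toSubmodule h
    exact bot_ne_top h1
  refine { toNontrivial := hnt, eq_bot_or_eq_top := fun W => ?_ }
  by_cases hW : W.toSubmodule = ⊥
  · exact Or.inl (Subrepresentation.toSubmodule_injective hW)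
  refine Or.inr (Subrepresentation.toSubmodule_injective ?_)
  change W.toSubmodule = ⊤
  obtain ⟨v, hv, hv0⟩ := (Submodule.ne_bot_iff _).1 hW
  obtain ⟨i, hi⟩ := Function.ne_iff.1 hv0
  have hinv : ∀ g : Gam, g.1 ∈ M1 → ∀ u ∈ W.toSubmodule, imRep g u ∈ W.toSubmodule :=
    fun g hg u hu => W.apply_mem_toSubmodule ⟨g.1, hg⟩ hu
  -- one step of the projection to the eigenline of `e i`
  have hstep : ∀ x : SPerm, IsAut x → x.perm = 1 → ∀ u ∈ W.toSubmodule,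
      (fun j => (1 + ((x.sign i.succ * x.sign j.succ : ℤˣ) : ℤ)) * u j : Fin 7 → ℂ) ∈
        W.toSubmodule := by
    intro x hx hp u hu
    have hs : sig (mkGam x hx) = 1 := by rw [sig_mkGam, hp]
    have h1 := hinv (mkGam x hx) (D_le_M1 (sig_eq_one_iff.1 hs)) u hu
    convert add_mem hu (W.toSubmodule.smul_mem ((x.sign i.succ : ℤ) : ℂ) h1) using 1
    ext j
    rw [Pi.add_apply, Pi.smul_apply, imRep_diag hs, code_mkGam, smul_eq_mul]
    push_cast
    ring
  have h1 := hstep n7 isAut_n7 rfl _ (hstep n2 isAut_n2 rfl _ (hstep n1 isAut_n1 rfl v hv))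
  have hsingle : (Pi.single i 1 : Fin 7 → ℂ) ∈ W.toSubmodule := by
    have key : ∀ i j : Fin 7, (1 + ((n7.sign i.succ * n7.sign j.succ : ℤˣ) : ℤ)) *
        ((1 + ((n2.sign i.succ * n2.sign j.succ : ℤˣ) : ℤ)) *
        (1 + ((n1.sign i.succ * n1.sign j.succ : ℤˣ) : ℤ))) = if j = i then 8 else 0 := by
      decide +kernel
    have h2 := W.toSubmodule.smul_mem (8 * v i)⁻¹ h1
    convert h2 using 1
    ext j
    have h3 := congrArg (Int.cast : ℤ → ℂ) (key i j)
    push_cast at h3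
    have hi' : v i ≠ 0 := hi
    rw [Pi.smul_apply, smul_eq_mul]
    push_cast
    rw [← mul_assoc (1 + _ : ℂ) (1 + _) (v j), ← mul_assoc (1 + _ : ℂ) _ (v j), h3, Pi.single_apply]
    by_cases hij : j = i
    · subst hij
      simp
      field_simp
    · simp [hij]
  have hall : ∀ j, (Pi.single j 1 : Fin 7 → ℂ) ∈ W.toSubmodule := by
    intro j
    have key : ∀ i j : Fin 7, ∃ k : Fin 7, (a ^ (k : ℕ)).perm i.succ = j.succ ∧
        (a ^ (k : ℕ)).sign i.succ = 1 := by decide +kernel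
    obtain ⟨k, hk1, hk2⟩ := key i j
    have h2 := hinv (ga ^ (k : ℕ)) (pow_mem (show ga ∈ M1.subgroupOf Gam from alpha_mem_M1) _) _
      hsingle
    convert h2 using 1
    ext l
    rw [imRep_single, apply_e_apply, sig_apply, map_pow, code_ga, hk1, hk2, Pi.single_apply]
    simp [apply_ite]
  rw [eq_top_iff]
  rintro u -
  rw [pi_eq_sum_univ' u]
  exact Submodule.sum_mem _ fun j _ => W.toSubmodule.smul_mem _ (by
    convert hall j using 1)

/-- The order of `x` is `1`, `2`, `3`, `6` or `7`, and its trace on the imaginary octonions is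
`7`, `-1`, `1`, `-1` or `0`, respectively. -/
def OrderTrace (x : SPerm) : Prop :=
  (x = 1 ∧ imTrace x = 7) ∨ (x ^ 2 = 1 ∧ x ≠ 1 ∧ imTrace x = -1) ∨
    (x ^ 3 = 1 ∧ x ≠ 1 ∧ imTrace x = 1) ∨
    (x ^ 6 = 1 ∧ x ^ 3 ≠ 1 ∧ x ^ 2 ≠ 1 ∧ imTrace x = -1) ∨
    (x ^ 7 = 1 ∧ x ≠ 1 ∧ imTrace x = 0)

instance (x : SPerm) : Decidable (OrderTrace x) := by unfold OrderTrace; infer_instance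

lemma orderTrace_of_mem : ∀ (p q r : Fin 2) (i : Fin 7) (j : Fin 3),
    OrderTrace (diag p q r * (a ^ (i : ℕ) * b ^ (j : ℕ))) := by
  rw [a_eq, b_eq]
  decide +kernel

lemma M1Rep_character (g : M1) : orderOf g ∈ ({1, 2, 3, 6, 7} : Set ℕ) ∧
    M1Rep.character g =
      if orderOf g = 1 then 7 else if orderOf g = 2 then -1
      else if orderOf g = 3 then 1 else if orderOf g = 6 then -1 else 0 := by
  obtain ⟨p, q, r, i, j, h⟩ := exists_of_mem_M1 g.2
  have hcode : code (Subgroup.inclusion M1_le_Gam g) =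
    diag p q r * (a ^ (i : ℕ) * b ^ (j : ℕ)) := code_eq_iff.2 h
  have hchar : M1Rep.character g = imTrace (diag p q r * (a ^ (i : ℕ) * b ^ (j : ℕ))) := by
    rw [← hcode]; exact imRep_trace _
  have hord : orderOf g = orderOf (diag p q r * (a ^ (i : ℕ) * b ^ (j : ℕ))) := by
    rw [← hcode, orderOf_injective code code_injective,
      orderOf_injective _ (Subgroup.inclusion_injective M1_le_Gam)]
  rw [hchar, hord]
  have H := orderTrace_of_mem p q r i j
  generalize diag p q r * (a ^ (i : ℕ) * b ^ (j : ℕ)) = x at H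
  rcases H with ⟨h1, h2⟩ | ⟨h1, h2, h3⟩ | ⟨h1, h2, h3⟩ | ⟨h1, h2, h3, h4⟩ | ⟨h1, h2, h3⟩
  · rw [orderOf_eq_one_iff.2 h1, h2]; norm_num
  · rw [orderOf_eq_prime h1 h2, h3]; norm_num
  · rw [orderOf_eq_prime h1 h2, h3]; norm_num
  · have h6 : orderOf x = 6 := by
      refine orderOf_eq_of_pow_and_pow_div_prime (by norm_num) h1 fun p hp hd => ?_
      have hp6 : p ≤ 6 := Nat.le_of_dvd (by norm_num) hd
      interval_cases p <;> first | exact h2 | exact h3 | omega | norm_num at hp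
    rw [h6, h4]; norm_num
  · have := fact_prime_seven
    rw [orderOf_eq_prime h1 h2, h3]; norm_num

/-! ### Octonion multiplication in coordinates -/

lemma omul_explicit (x y : Oct) : omul x y = ![
      x 0 * y 0 - x 1 * y 1 - x 2 * y 2 - x 3 * y 3 - x 4 * y 4 - x 5 * y 5 - x 6 * y 6 - x 7 * y 7,
      x 0 * y 1 + x 1 * y 0 + x 2 * y 3 - x 3 * y 2 + x 4 * y 7 - x 5 * y 6 + x 6 * y 5 - x 7 * y 4,
      x 0 * y 2 - x 1 * y 3 + x 2 * y 0 + x 3 * y 1 + x 4 * y 6 + x 5 * y 7 - x 6 * y 4 - x 7 * y 5,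
      x 0 * y 3 + x 1 * y 2 - x 2 * y 1 + x 3 * y 0 - x 4 * y 5 + x 5 * y 4 + x 6 * y 7 - x 7 * y 6,
      x 0 * y 4 - x 1 * y 7 - x 2 * y 6 + x 3 * y 5 + x 4 * y 0 - x 5 * y 3 + x 6 * y 2 + x 7 * y 1,
      x 0 * y 5 + x 1 * y 6 - x 2 * y 7 - x 3 * y 4 + x 4 * y 3 + x 5 * y 0 - x 6 * y 1 + x 7 * y 2,
      x 0 * y 6 - x 1 * y 5 + x 2 * y 4 - x 3 * y 7 - x 4 * y 2 + x 5 * y 1 + x 6 * y 0 + x 7 * y 3,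
      x 0 * y 7 + x 1 * y 4 + x 2 * y 5 + x 3 * y 6 - x 4 * y 1 - x 5 * y 2 - x 6 * y 3 + x 7 * y 0] := by
  have h : ∀ k i j : Fin 8, coeff i j k = if j = idx i k then (sgn i (idx i k) : ℤ) else 0 := by
    decide +kernel
  have hj : ∀ k i : Fin 8, idx i k = (![
      ![0, 1, 2, 3, 4, 5, 6, 7],
      ![1, 0, 3, 2, 7, 6, 5, 4],
      ![2, 3, 0, 1, 6, 7, 4, 5],
      ![3, 2, 1, 0, 5, 4, 7, 6],
      ![4, 7, 6, 5, 0, 3, 2, 1],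
      ![5, 6, 7, 4, 3, 0, 1, 2],
      ![6, 5, 4, 7, 2, 1, 0, 3],
      ![7, 4, 5, 6, 1, 2, 3, 0]] : Fin 8 → Fin 8 → Fin 8) k i := by
    decide +kernel
  have hs : ∀ k i : Fin 8, (sgn i (idx i k) : ℤ) = (![
      ![1, -1, -1, -1, -1, -1, -1, -1],
      ![1, 1, 1, -1, 1, -1, 1, -1],
      ![1, -1, 1, 1, 1, 1, -1, -1],
      ![1, 1, -1, 1, -1, 1, 1, -1],
      ![1, -1, -1, 1, 1, -1, 1, 1],
      ![1, 1, -1, -1, 1, 1, -1, 1],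
      ![1, -1, 1, -1, -1, 1, 1, 1],
      ![1, 1, 1, 1, -1, -1, -1, 1]] : Fin 8 → Fin 8 → ℤ) k i := by
    decide +kernel
  have h1 : ∀ k, omul x y k = ∑ i, ((sgn i (idx i k) : ℤ) : ℝ) * (x i * y (idx i k)) := by
    intro k
    refine Finset.sum_congr rfl fun i _ => ?_
    simp [h]
  ext k
  rw [h1]
  simp only [hs]
  simp only [hj]
  rw [Fin.sum_univ_eight]
  fin_cases k <;> simp <;> ring

/-! ### Matrix groups from coordinates -/

/-- A linear action of a subgroup on the image of an injective coordinate map, given by matrices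
from a submonoid `S`, is a homomorphism to `S`. -/
lemma exists_matrixHom {R n : Type*} [CommRing R] [Fintype n] [DecidableEq n]
    (E : Subgroup (Oct ≃ₗ[ℝ] Oct)) {S : Type*} [Group S] (m : S →* Matrix n n R)
    (hm : Function.Injective m)
    (f : (n → R) → Oct) (hf : Function.Injective f)
    (h : ∀ g ∈ E, ∃ A : S, ∀ z, g (f z) = f ((m A).mulVec z)) :
    ∃ ρ : E →* S, ∀ (g : E) z, g.1 (f z) = f ((m (ρ g)).mulVec z) := by
  choose A hA using fun g : E => h g.1 g.2
  have hext : ∀ {B C : S}, (∀ z, f ((m B).mulVec z) = f ((m C).mulVec z)) → B = C :=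
    fun H => hm (Matrix.mulVec_injective (funext fun z => hf (H z)))
  refine ⟨⟨⟨A, hext fun z => ?_⟩, fun g g' => hext fun z => ?_⟩, hA⟩
  · rw [← hA, map_one, Matrix.one_mulVec]; rfl
  · rw [← hA, map_mul, ← Matrix.mulVec_mulVec, ← hA, ← hA]; rfl

/-- Automorphisms of the octonions that agree on `e₁, e₃, e₅, e₇` are equal. -/
lemma eq_of_apply_offLine {g h : Oct ≃ₗ[ℝ] Oct} (hg : g ∈ G2) (hh : h ∈ G2)
    (H : ∀ i ∈ offLine, g (e i) = h (e i)) : g = h := by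
  have hmul : ∀ {i j}, g (e i) = h (e i) → g (e j) = h (e j) →
      g (e (idx i j)) = h (e (idx i j)) := by
    intro i j hi hj
    have h1 := hg (e i) (e j)
    rw [hi, hj, ← hh, omul_e, map_smul, map_smul] at h1
    exact smul_right_injective Oct (by exact_mod_cast (sgn i j).ne_zero) h1
  have h1 := H 1 (by decide)
  have h3 := H 3 (by decide)
  have h5 := H 5 (by decide)
  have h7 := H 7 (by decide)
  refine linearEquiv_ext_e fun i => ?_
  fin_cases i
  exacts [(apply_e_zero hg).trans (apply_e_zero hh).symm, h1, hmul h1 h3, h3, hmul h3 h5, h5,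
    hmul h3 h7, h7]

/-! ### The action on the complement of `e₆` by `SU(3)` -/

lemma complexCoord_explicit (z : Fin 3 → ℂ) : complexCoord z =
    ![0, (z 2).im, (z 0).re, (z 1).im, (z 0).im, (z 2).re, 0, (z 1).re] := by
  ext k
  simp only [complexCoord, Fin.sum_univ_three]
  fin_cases k <;> simp [e_apply]

/-- The complex coordinates of an octonion. -/
def toComplex (x : Oct) : Fin 3 → ℂ := fun i => ⟨x (![2, 7, 5] i), x (![4, 3, 1] i)⟩

lemma toComplex_complexCoord (z : Fin 3 → ℂ) : toComplex (complexCoord z) = z := by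
  rw [complexCoord_explicit]
  ext i
  fin_cases i <;> rfl

lemma complexCoord_injective : Function.Injective complexCoord :=
  Function.LeftInverse.injective toComplex_complexCoord

lemma complexCoord_toComplex {x : Oct} (h0 : x 0 = 0) (h6 : x 6 = 0) :
    complexCoord (toComplex x) = x := by
  rw [complexCoord_explicit]
  ext i
  fin_cases i
  exacts [h0.symm, rfl, rfl, rfl, rfl, rfl, h6.symm, rfl]

/-- Left multiplication by `e₆` is multiplication by the imaginary unit. -/
lemma omul_e6_complexCoord (z : Fin 3 → ℂ) :
    omul (e 6) (complexCoord z) = complexCoord (Complex.I • z) := by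
  rw [omul_explicit, complexCoord_explicit, complexCoord_explicit]
  ext k
  fin_cases k <;> simp [e_apply]

/-- The components of a product along `e₀` and `e₆` are given by the Hermitian form. -/
lemma omul_complexCoord_zero (u v : Fin 3 → ℂ) :
    omul (complexCoord u) (complexCoord v) 0 = -(∑ k, star (u k) * v k).re := by
  rw [omul_explicit, complexCoord_explicit, complexCoord_explicit]
  simp [Fin.sum_univ_three]
  ring

lemma omul_complexCoord_six (u v : Fin 3 → ℂ) :
    omul (complexCoord u) (complexCoord v) 6 = (∑ k, star (u k) * v k).im := by
  rw [omul_explicit, complexCoord_explicit, complexCoord_explicit]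
  simp [Fin.sum_univ_three]
  ring

/-- The components of a product orthogonal to `e₀` and `e₆` are those of the complex conjugate of
the vector product. -/
lemma toComplex_omul (u v : Fin 3 → ℂ) :
    toComplex (omul (complexCoord u) (complexCoord v)) =
      ![star (v 1 * u 2 - v 2 * u 1), star (v 2 * u 0 - v 0 * u 2), star (v 0 * u 1 - v 1 * u 0)] := by
  rw [omul_explicit, complexCoord_explicit, complexCoord_explicit]
  ext i
  apply Complex.ext <;> fin_cases i <;> simp [toComplex] <;> ring

lemma apply_zero (g : Gam) (v : Oct) : g.1 v 0 = v 0 := by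
  have h := apply_coord g v 0
  rwa [sig_zero, (isAut_code g).sign_zero, Units.val_one, Int.cast_one, one_mul] at h

/-- An element that fixes `e₆` is complex linear on the complement, and it preserves the Hermitian
form and the complex volume form because both are expressed by the octonion product. -/
lemma exists_SU3 {g : Oct ≃ₗ[ℝ] Oct} (hg : g ∈ Gam) (h6 : g (e 6) = e 6) :
    ∃ U ∈ Matrix.specialUnitaryGroup (Fin 3) ℂ, ∀ z,
      g (complexCoord z) = complexCoord (U.mulVec z) := by
  have hmul : ∀ x y, g (omul x y) = omul (g x) (g y) := hg.1
  have hc0 : ∀ v, g v 0 = v 0 := apply_zero ⟨g, hg⟩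
  have hc6 : ∀ v, g v 6 = v 6 := by
    intro v
    have h1 := apply_e ⟨g, hg⟩ 6
    change g (e 6) = _ at h1
    have h2 := smul_e_inj (s := 1) (i := 6) (by rw [← h1, h6]; simp)
    have h3 := apply_coord ⟨g, hg⟩ v 6
    rw [← h2.1, ← h2.2] at h3
    simpa using h3
  let u : Fin 3 → Fin 3 → ℂ := fun j => toComplex (g (e (![2, 7, 5] j)))
  have hu : ∀ j, g (e (![2, 7, 5] j)) = complexCoord (u j) := fun j => by
    refine (complexCoord_toComplex ?_ ?_).symm
    · rw [hc0]; fin_cases j <;> simp [e_apply]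
    · rw [hc6]; fin_cases j <;> simp [e_apply]
  have hu' : ∀ j, g (e (![4, 3, 1] j)) = complexCoord (Complex.I • u j) := fun j => by
    have h1 : e (![4, 3, 1] j) = omul (e 6) (e (![2, 7, 5] j)) := by
      have h2 : ∀ j : Fin 3, sgn 6 (![2, 7, 5] j) = 1 ∧ idx 6 (![2, 7, 5] j) = ![4, 3, 1] j := by
        decide +kernel
      rw [omul_e, (h2 j).1, (h2 j).2]; simp
    rw [h1, hmul, h6, hu, omul_e6_complexCoord]
  have hherm : ∀ i j, ∑ k, star (u i k) * u j k = if i = j then 1 else 0 := by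
    intro i j
    have h1 : omul (complexCoord (u i)) (complexCoord (u j)) =
        g (omul (e (![2, 7, 5] i)) (e (![2, 7, 5] j))) := by rw [hmul, hu, hu]
    apply Complex.ext
    · rw [← neg_neg (Complex.re _), ← omul_complexCoord_zero, h1, hc0, omul_explicit]
      fin_cases i <;> fin_cases j <;> simp [e_apply]
    · rw [← omul_complexCoord_six, h1, hc6, omul_explicit]
      fin_cases i <;> fin_cases j <;> simp [e_apply]
  -- the relation `e₇ e₂ = e₅`
  have hcross : u 2 = toComplex (omul (complexCoord (u 1)) (complexCoord (u 0))) := by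
    have h1 : omul (e 7) (e 2) = e 5 := by
      rw [omul_e, show sgn 7 2 = 1 by decide +kernel, show idx 7 2 = 5 by decide +kernel]; simp
    have h2 := hu 0
    have h3 := hu 1
    change g (e 2) = _ at h2
    change g (e 7) = _ at h3
    rw [← h2, ← h3, ← hmul, h1]
    rfl
  rw [toComplex_omul] at hcross
  let U : Matrix (Fin 3) (Fin 3) ℂ := Matrix.of fun i j => u j i
  refine ⟨U, Matrix.mem_specialUnitaryGroup_iff.2 ⟨Matrix.mem_unitaryGroup_iff'.2 ?_, ?_⟩, ?_⟩
  · ext i j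
    rw [Matrix.mul_apply, Matrix.one_apply, ← hherm i j]
    rfl
  · have h22 := hherm 2 2
    have e0 := congrArg star (congrFun hcross 0)
    have e1 := congrArg star (congrFun hcross 1)
    have e2 := congrArg star (congrFun hcross 2)
    simp only [Matrix.cons_val_zero, Matrix.cons_val_one, Matrix.cons_val, star_star] at e0 e1 e2
    rw [Fin.sum_univ_three, e0, e1, e2, if_pos rfl] at h22
    rw [Matrix.det_fin_three]
    simp only [U, Matrix.of_apply]
    linear_combination h22
  · intro z
    have h1 : g (complexCoord z) = ∑ j, ((z j).re • complexCoord (u j) +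
        (z j).im • complexCoord (Complex.I • u j)) := by
      rw [complexCoord, map_sum]
      simp only [map_add, map_smul, hu, hu']
    rw [h1]
    simp only [complexCoord_explicit, Fin.sum_univ_three, Matrix.mulVec, dotProduct, U,
      Matrix.of_apply]
    ext k
    fin_cases k <;> simp <;> ring

lemma K_rep : ∃ ρ : K →* Matrix.specialUnitaryGroup (Fin 3) ℂ, Function.Injective ρ ∧
    ∀ (g : K) (z : Fin 3 → ℂ), g.1 (complexCoord z) = complexCoord ((ρ g).1.mulVec z) := by
  have hK : ∀ g ∈ K, g ∈ Gam := fun g hg => M2_le_Gam (K_le_M2 hg)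
  obtain ⟨ρ, hρ⟩ := exists_matrixHom K (Matrix.specialUnitaryGroup (Fin 3) ℂ).subtype
    Subtype.val_injective complexCoord complexCoord_injective fun g hg => by
      obtain ⟨U, hU, h⟩ := exists_SU3 (hK g hg) (mem_K_iff.1 hg).2
      exact ⟨⟨U, hU⟩, h⟩
  refine ⟨ρ, fun g h hgh => Subtype.ext ?_, hρ⟩
  have hz : ∀ z, g.1 (complexCoord z) = h.1 (complexCoord z) := fun z => by rw [hρ, hρ, hgh]
  refine eq_of_apply_offLine (hK _ g.2).1 (hK _ h.2).1 fun i hi => ?_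
  have hex : ∀ i ∈ offLine, ∃ z, complexCoord z = e i := by
    intro i hi
    refine ⟨toComplex (e i), complexCoord_toComplex ?_ ?_⟩ <;> rw [e_apply, if_neg] <;>
      rintro rfl <;> exact absurd hi (by decide)
  obtain ⟨z, hz'⟩ := hex i hi
  rw [← hz', hz]

/-- `N₁` acts as complex conjugation followed by `diag(1, -1, -1)`. -/
lemma N1_complexCoord (z : Fin 3 → ℂ) :
    N1 (complexCoord z) = complexCoord ((Matrix.diagonal ![1, -1, -1]).mulVec (star z)) := by
  have h1 : ∀ v : Oct, N1 v = fun i => ((n1.sign i : ℤ) : ℝ) * v i := by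
    intro v
    rw [← toLin_n1]; rfl
  rw [h1, complexCoord_explicit, complexCoord_explicit]
  ext k
  fin_cases k <;> simp [n1, Matrix.mulVec_diagonal]

lemma M2_conj {g : Oct ≃ₗ[ℝ] Oct} (hg : g ∈ M2) (hK : g ∉ K) :
    ∃ U ∈ Matrix.specialUnitaryGroup (Fin 3) ℂ, ∀ z : Fin 3 → ℂ,
      g (complexCoord z) = complexCoord (U.mulVec (star z)) := by
  have h6 : (g * N1) (e 6) = e 6 := by
    change g (N1 (e 6)) = _
    rw [N1_apply_e6, map_neg, apply_e6_of_not_mem_K hg hK, neg_neg]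
  obtain ⟨U, hU, h⟩ := exists_SU3 (mul_mem (M2_le_Gam hg) (D_le_Gam N1_mem_D)) h6
  have hd : Matrix.diagonal ![1, -1, -1] ∈ Matrix.specialUnitaryGroup (Fin 3) ℂ := by
    refine Matrix.mem_specialUnitaryGroup_iff.2 ⟨Matrix.mem_unitaryGroup_iff'.2 ?_, ?_⟩
    · rw [Matrix.star_eq_conjTranspose, Matrix.diagonal_conjTranspose, Matrix.diagonal_mul_diagonal,
        ← Matrix.diagonal_one]
      congr 1
      ext i
      fin_cases i <;> simp
    · rw [Matrix.det_diagonal, Fin.prod_univ_three]; simp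
  refine ⟨U * Matrix.diagonal ![1, -1, -1], mul_mem hU hd, fun z => ?_⟩
  rw [← Matrix.mulVec_mulVec, ← h]
  change _ = g (N1 _)
  rw [← N1_complexCoord]
  change _ = g ((N1 * N1) _)
  rw [N1_mul_self]
  rfl

/-! ### The action on the complement of a quaternion subalgebra by `SO(4)` -/

lemma realCoord_explicit (v : Fin 4 → ℝ) : realCoord v = ![0, v 0, 0, v 1, 0, v 2, 0, v 3] := by
  ext k
  simp only [realCoord, Fin.sum_univ_four]
  fin_cases k <;> simp [e_apply]

/-- The coordinates of an octonion along `e₁, e₃, e₅, e₇`. -/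
def toReal (x : Oct) : Fin 4 → ℝ := fun i => x (![1, 3, 5, 7] i)

lemma toReal_realCoord (v : Fin 4 → ℝ) : toReal (realCoord v) = v := by
  rw [realCoord_explicit]
  ext i
  fin_cases i <;> rfl

lemma realCoord_injective : Function.Injective realCoord :=
  Function.LeftInverse.injective toReal_realCoord

lemma realCoord_toReal {x : Oct} (h : ∀ i ∉ offLine, x i = 0) : realCoord (toReal x) = x := by
  rw [realCoord_explicit]
  ext i
  fin_cases i
  exacts [(h 0 (by decide)).symm, rfl, (h 2 (by decide)).symm, rfl, (h 4 (by decide)).symm, rfl,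
    (h 6 (by decide)).symm, rfl]

lemma omul_realCoord_zero (u v : Fin 4 → ℝ) :
    omul (realCoord u) (realCoord v) 0 = -∑ k, u k * v k := by
  rw [omul_explicit, realCoord_explicit, realCoord_explicit]
  simp [Fin.sum_univ_four]
  ring

/-- The associator `(x y) z - x (y z)` of three octonions. -/
def assoc (x y z : Oct) : Oct := omul (omul x y) z - omul x (omul y z)

/-- On the complement of the quaternion subalgebra the associator, paired with a fourth vector, is a
multiple of the volume form. -/
lemma assoc_det (U : Matrix (Fin 4) (Fin 4) ℝ) :
    ∑ k, toReal (assoc (realCoord (fun i => U i 0)) (realCoord (fun i => U i 1))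
      (realCoord (fun i => U i 2))) k * U k 3 = (-2) * U.det := by
  simp only [assoc, toReal, omul_explicit, realCoord_explicit, Fin.sum_univ_four]
  rw [Matrix.det_succ_row_zero]
  simp [Matrix.det_fin_three, Fin.sum_univ_four, Matrix.submatrix_apply, Fin.succAbove]
  ring

/-- An element of `M₃` acts orthogonally on the complement of the quaternion subalgebra, and it
preserves the volume form because that form is expressed by the associator. -/
lemma exists_SO4 {g : Oct ≃ₗ[ℝ] Oct} (hg : g ∈ M3) :
    ∃ U ∈ Matrix.specialOrthogonalGroup (Fin 4) ℝ, ∀ v,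
      g (realCoord v) = realCoord (U.mulVec v) := by
  have hG := M3_le_Gam hg
  have hmul : ∀ x y, g (omul x y) = omul (g x) (g y) := hG.1
  have hc0 : ∀ v, g v 0 = v 0 := apply_zero ⟨g, hG⟩
  let u : Fin 4 → Fin 4 → ℝ := fun j => toReal (g (e (![1, 3, 5, 7] j)))
  have hu : ∀ j, g (e (![1, 3, 5, 7] j)) = realCoord (u j) := fun j => by
    refine (realCoord_toReal fun i hi => ?_).symm
    have h1 := apply_e_apply ⟨g, hG⟩ i (![1, 3, 5, 7] j)
    refine h1.trans (if_neg fun h => hi ?_)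
    rw [h, (mem_M3_iff ⟨g, hG⟩).1 hg]
    fin_cases j <;> decide
  have horth : ∀ i j, ∑ k, u i k * u j k = if i = j then 1 else 0 := by
    intro i j
    have h1 : omul (realCoord (u i)) (realCoord (u j)) =
        g (omul (e (![1, 3, 5, 7] i)) (e (![1, 3, 5, 7] j))) := by rw [hmul, hu, hu]
    rw [← neg_neg (∑ k, u i k * u j k), ← omul_realCoord_zero, h1, hc0, omul_explicit]
    fin_cases i <;> fin_cases j <;> simp [e_apply]
  have hassoc : assoc (realCoord (u 0)) (realCoord (u 1)) (realCoord (u 2)) =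
      (-2 : ℝ) • realCoord (u 3) := by
    have h1 : assoc (e 1) (e 3) (e 5) = (-2 : ℝ) • e 7 := by
      ext k
      simp only [assoc, omul_explicit]
      fin_cases k <;> simp [e_apply]
      norm_num
    have h2 : ∀ x y z, g (assoc x y z) = assoc (g x) (g y) (g z) := fun x y z => by
      rw [assoc, map_sub, hmul, hmul, hmul, hmul]; rfl
    have h3 := congrArg g h1
    rw [h2, map_smul] at h3
    rw [← hu 0, ← hu 1, ← hu 2, ← hu 3]
    exact h3
  let U : Matrix (Fin 4) (Fin 4) ℝ := Matrix.of fun i j => u j i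
  refine ⟨U, Matrix.mem_specialOrthogonalGroup_iff.2
    ⟨(Matrix.mem_orthogonalGroup_iff' _ _).2 ?_, ?_⟩, ?_⟩
  · ext i j
    rw [Matrix.mul_apply, Matrix.one_apply, ← horth i j]
    rfl
  · have h1 := assoc_det U
    change ∑ k, toReal (assoc (realCoord (u 0)) (realCoord (u 1)) (realCoord (u 2))) k * u 3 k = _
      at h1
    rw [hassoc] at h1
    have h2 : ∀ k, toReal ((-2 : ℝ) • realCoord (u 3)) k = (-2) * u 3 k := fun k =>
      congrArg ((-2 : ℝ) * ·) (congrFun (toReal_realCoord (u 3)) k)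
    have h3 := horth 3 3
    simp only [h2, mul_assoc, ← Finset.mul_sum] at h1
    rw [h3, if_pos rfl] at h1
    linarith
  · intro v
    have h1 : g (realCoord v) = ∑ j, v j • realCoord (u j) := by
      rw [realCoord, map_sum]
      simp only [map_smul, hu]
    rw [h1]
    simp only [realCoord_explicit, Fin.sum_univ_four, Matrix.mulVec, dotProduct, U, Matrix.of_apply]
    ext k
    fin_cases k <;> simp <;> ring

lemma M3_rep : ∃ ρ : M3 →* Matrix.specialOrthogonalGroup (Fin 4) ℝ, Function.Injective ρ ∧
    ∀ (g : M3) (v : Fin 4 → ℝ), g.1 (realCoord v) = realCoord ((ρ g).1.mulVec v) := by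
  obtain ⟨ρ, hρ⟩ := exists_matrixHom M3 (Matrix.specialOrthogonalGroup (Fin 4) ℝ).subtype
    Subtype.val_injective realCoord realCoord_injective fun g hg => by
      obtain ⟨U, hU, h⟩ := exists_SO4 hg
      exact ⟨⟨U, hU⟩, h⟩
  refine ⟨ρ, fun g h hgh => Subtype.ext ?_, hρ⟩
  have hv : ∀ v, g.1 (realCoord v) = h.1 (realCoord v) := fun v => by rw [hρ, hρ, hgh]
  refine eq_of_apply_offLine (M3_le_Gam g.2).1 (M3_le_Gam h.2).1 fun i hi => ?_
  have hex : realCoord (toReal (e i)) = e i := realCoord_toReal fun j hj => by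
    rw [e_apply, if_neg]; rintro rfl; exact hj hi
  rw [← hex, hv]

end OctonionUnits

end

open OctonionUnits in
theorem mainTheorem2 :
    -- the group `2³·PSL₂(7)`
    (Nat.card Gam = 1344 ∧ D ≤ Gam ∧ Nonempty (D ≃* ElemTwo 3) ∧
      IsNonsplitExt (D.subgroupOf Gam) PSL(2, ZMod 7)) ∧
    -- its maximal subgroups, up to conjugacy
    (M1 ≤ Gam ∧ M2 ≤ Gam ∧ M3 ≤ Gam ∧
      (∀ H : Subgroup Gam, IsCoatom H ↔
        AreConj H (M1.subgroupOf Gam) ∨ AreConj H (M2.subgroupOf Gam) ∨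
          AreConj H (M3.subgroupOf Gam)) ∧
      ¬ AreConj (M1.subgroupOf Gam) (M2.subgroupOf Gam) ∧
      ¬ AreConj (M1.subgroupOf Gam) (M3.subgroupOf Gam) ∧
      ¬ AreConj (M2.subgroupOf Gam) (M3.subgroupOf Gam)) ∧
    -- `2³:7:3`, a subgroup of `G₂` acting irreducibly on the imaginary octonions
    (Nat.card M1 = 168 ∧ M1 ≤ G2 ∧
      D ≤ M1 ∧ F21 ≤ M1 ∧ (D.subgroupOf M1).IsComplement' (F21.subgroupOf M1) ∧
      IsSplitExt (D.subgroupOf M1) F21 ∧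
      (∃ C : Subgroup F21, Nonempty (C ≃* Multiplicative (ZMod 7)) ∧
        IsSplitExt C (Multiplicative (ZMod 3))) ∧
      (¬ ∀ x y : F21, x * y = y * x) ∧
      ∃ ρ : Representation ℂ M1 (Fin 7 → ℂ),
        (∀ (g : M1) (i j : Fin 7), ρ g (Pi.single j 1) i = (g.1 (e j.succ) i.succ : ℂ)) ∧
        (∀ (g : M1) (j : Fin 7), g.1 (e j.succ) 0 = 0) ∧
        ρ.IsIrreducible ∧
        ∀ g : M1, orderOf g ∈ ({1, 2, 3, 6, 7} : Set ℕ) ∧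
          ρ.character g =
            if orderOf g = 1 then 7 else if orderOf g = 2 then -1
            else if orderOf g = 3 then 1 else if orderOf g = 6 then -1 else 0) ∧
    -- `4·S₄:2`, the stabilizer of `{e₆, -e₆}`; its elements act on `ℂ³` through `SU(3)`,
    -- composed with complex conjugation if they interchange `e₆` and `-e₆`
    (Nat.card M2 = 192 ∧
      M2 = Gam ⊓ MulAction.stabilizer (Oct ≃ₗ[ℝ] Oct) ({e 6, -e 6} : Set Oct) ∧
      IsSplitExt (K.subgroupOf M2) (Multiplicative (ZMod 2)) ∧
      Nonempty ((D ⊓ K : Subgroup (Oct ≃ₗ[ℝ] Oct)) ≃* ElemTwo 2) ∧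
      IsNonsplitExt ((D ⊓ K).subgroupOf K) (Equiv.Perm (Fin 4)) ∧
      (∃ ρ : K →* Matrix.specialUnitaryGroup (Fin 3) ℂ, Function.Injective ρ ∧
        ∀ (g : K) (z : Fin 3 → ℂ),
          g.1 (complexCoord z) = complexCoord ((ρ g).1.mulVec z)) ∧
      ∀ g ∈ M2, g ∉ K → g (e 6) = -e 6 ∧
        ∃ U ∈ Matrix.specialUnitaryGroup (Fin 3) ℂ, ∀ z : Fin 3 → ℂ,
          g (complexCoord z) = complexCoord (U.mulVec (star z))) ∧
    -- `2³·S₄`, acting faithfully through `SO(4)` on the complement of the quaternion subalgebra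
    (Nat.card M3 = 192 ∧ D ≤ M3 ∧
      IsNonsplitExt (D.subgroupOf M3) (Equiv.Perm (Fin 4)) ∧
      ∃ ρ : M3 →* Matrix.specialOrthogonalGroup (Fin 4) ℝ, Function.Injective ρ ∧
        ∀ (g : M3) (v : Fin 4 → ℝ),
          g.1 (realCoord v) = realCoord ((ρ g).1.mulVec v)) := by
  have hcoatom : ∀ H : Subgroup Gam, IsCoatom H ↔
      AreConj H (M1.subgroupOf Gam) ∨ AreConj H (M2.subgroupOf Gam) ∨
        AreConj H (M3.subgroupOf Gam) := by
    intro H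
    rw [isCoatom_iff, AreConj, AreConj, AreConj, ← exists_or, ← exists_or]
    refine exists_congr fun x => ?_
    simp only [Set.mem_insert_iff, Set.mem_singleton_iff, exists_eq_or_imp, exists_eq_left]
  have c1 : Nat.card (M1.subgroupOf Gam) = 168 :=
    (Nat.card_congr (Subgroup.subgroupOfEquivOfLe M1_le_Gam).toEquiv).trans card_M1
  have c2 : Nat.card (M2.subgroupOf Gam) = 192 :=
    (Nat.card_congr (Subgroup.subgroupOfEquivOfLe M2_le_Gam).toEquiv).trans card_M2
  have c3 : Nat.card (M3.subgroupOf Gam) = 192 :=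
    (Nat.card_congr (Subgroup.subgroupOfEquivOfLe M3_le_Gam).toEquiv).trans card_M3
  refine ⟨⟨card_Gam, D_le_Gam, D_equiv, Gam_nonsplit⟩,
    ⟨M1_le_Gam, M2_le_Gam, M3_le_Gam, hcoatom, not_areConj_of_card_ne (by rw [c1, c2]; norm_num),
      not_areConj_of_card_ne (by rw [c1, c3]; norm_num), not_areConj_M2_M3⟩,
    ⟨card_M1, M1_le_Gam.trans inf_le_left, D_le_M1, F21_le_M1, M1_isComplement.2,
      ⟨M1_isComplement.1, _, M1_isComplement.2, ⟨Subgroup.subgroupOfEquivOfLe F21_le_M1⟩⟩,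
      F21_structure, F21_not_comm, M1Rep, fun g i j => ?_, fun g j => ?_, M1Rep_irreducible,
      M1Rep_character⟩,
    ⟨card_M2, M2_eq_Stab6, M2_split, D_inf_K_equiv, K_nonsplit, K_rep,
      fun g hg hK => ⟨apply_e6_of_not_mem_K hg hK, M2_conj hg hK⟩⟩,
    ⟨card_M3, D_le_M3, M3_nonsplit, M3_rep⟩⟩
  · exact imRep_single (Subgroup.inclusion M1_le_Gam g) i j
  · exact apply_e_succ_zero (Subgroup.inclusion M1_le_Gam g) j
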